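/- Consider tabular finite-horizon MDPs with horizon $H\ge 1$, state set $\{1,\dots,S\}$, action set $\{1,\dots,A\}$ ($S,A\ge 1$), a fixed deterministic initial state $s_1$, time-inhomogeneous transition probabilities $P_{h,s,a}$, and reward distributions supported in $[0,1]$ with means $R_{h,s,a}$; let $\mathcal M$ be the class of all of them. For a deterministic Markov policy $\pi=(\pi_1,\dots,\pi_H)$ let $V_h^{\pi}$ be its value functions, given by $V^\pi_{H+1}=0$ and $V_h^\pi(s)=R_{h,s,\pi_h(s)}+\sum_{s'}P_{h,s,\pi_h(s)}(s')V^\pi_{h+1}(s')$, and let $V_h^*(s)=\max_\pi V_h^\pi(s)$. $\mathrm{RLSVI}_\beta$ with tuning parameters $\beta=(\beta_k)_{k\ge1}$ acts as follows in episode $k=1,2,\dots$. Let $n_k(h,s,a)$ be the number of previous episodes in which action $a$ was played in state $s$ at period $h$, and let $\hat R^k_{h,s,a}$ and $\hat P^k_{h,s,a}$ be the empirical mean reward and the empirical transition frequencies from these visits (both $0$ if $n_k(h,s,a)=0$). Conditionally on the history, draw independent $w^k(h,s,a)\sim N\bigl(0,\beta_k/(n_k(h,s,a)+1)\bigr)$.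 Let $\pi^k$ be a policy that is optimal (at every period and state) for the perturbed model with transitions $\hat P^k$ and rewards $\hat R^k+w^k$, ties being broken by an arbitrary fixed rule; follow $\pi^k$ throughout episode $k$. For $M\in\mathcal M$ define $$\mathrm{Regret}(M,K,\mathrm{RLSVI}_\beta)=\mathbb E\Bigl[\sum_{k=1}^K\bigl(V_1^*(s_1)-V_1^{\pi^k}(s_1)\bigr)\Bigr],$$ where the expectation is over the algorithm's noise and over the observed rewards and transitions. Theorem. There are absolute constants $C>0$ and $p\in\mathbb N$ such that for all integers $H,S,A,K\ge1$, with $\beta_k=\tfrac12 SH^3\log(2HSAk)$ for all $k\geq 1$, $$\sup_{M\in\mathcal M}\mathrm{Regret}(M,K,\mathrm{RLSVI}_\beta)\;\le\; C\,\bigl(\log(2HSAK)\bigr)^p\,H^3S^{3/2}\sqrt{AK}.$$ -/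

import Mathlib

open MeasureTheory ProbabilityTheory

noncomputable section

namespace RVF

/-- A finite-horizon, time-inhomogeneous MDP with `S` states, `A` actions, `H` periods (indexed from
`0`) and rewards in `[0,1]`.  `outcome h s a` is the joint law of the reward and of the next state
when action `a` is played in state `s` at period `h`; its two marginals are the reward distribution
and the transition kernel.  No independence of reward and next state is imposed. -/
structure MDP (H S A : ℕ) where
  /-- The deterministic initial state. -/
  init : Fin S
  /-- The joint law of reward and next state. -/
  outcome : Fin H → Fin S → Fin A → Measure (ℝ × Fin S)
  isProb : ∀ h s a, IsProbabilityMeasure (outcome h s a)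
  reward_mem : ∀ h s a, ∀ᵐ x ∂(outcome h s a), x.1 ∈ Set.Icc (0 : ℝ) 1

attribute [instance] MDP.isProb

/-- Deterministic Markov policies. -/
abbrev Policy (H S A : ℕ) : Type := Fin H → Fin S → Fin A

/-- The transition arrays and expected reward arrays `(P, R)` of an MDP.  They are arbitrary real
arrays, so that empirical and perturbed MDPs are covered. -/
structure Tabular (H S A : ℕ) where
  /-- `P h s a s'`. -/
  P : Fin H → Fin S → Fin A → Fin S → ℝ
  /-- `R h s a`. -/
  R : Fin H → Fin S → Fin A → ℝ

/-- Transition probabilities and mean rewards of an MDP. -/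
def MDP.tabular {H S A : ℕ} (M : MDP H S A) : Tabular H S A where
  P h s a s' := (M.outcome h s a).real {x | x.2 = s'}
  R h s a := ∫ x, x.1 ∂(M.outcome h s a)

/-- The value function of `π` from period `h` on, given by the Bellman equations; it vanishes
after the last period. -/
def value {H S A : ℕ} (m : Tabular H S A) (π : Policy H S A) (h : ℕ) (s : Fin S) : ℝ :=
  if hh : h < H then
    m.R ⟨h, hh⟩ s (π ⟨h, hh⟩ s)
      + ∑ s' : Fin S, m.P ⟨h, hh⟩ s (π ⟨h, hh⟩ s) s' * value m π (h + 1) s'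
  else 0
termination_by H - h

/-- The optimal value function: the maximum over the (finitely many) policies. -/
def optValue {H S A : ℕ} (m : Tabular H S A) (h : ℕ) (s : Fin S) : ℝ :=
  ⨆ π : Policy H S A, value m π h s

/-- A policy is optimal if it maximizes the value at every period and state. -/
def IsOptimal {H S A : ℕ} (m : Tabular H S A) (π : Policy H S A) : Prop :=
  ∀ (h : ℕ) (s : Fin S) (π' : Policy H S A), value m π' h s ≤ value m π h s

/-- State, action and reward at each of `h` successive periods. -/
abbrev Steps (S A h : ℕ) : Type := Fin h → Fin S × Fin A × ℝ

/-- The record of one episode. -/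
abbrev Episode (H S A : ℕ) : Type := Steps S A H

/-- The history of the first `k` episodes. -/
abbrev History (H S A k : ℕ) : Type := Fin k → Episode H S A

/-- The law of reward and next state at period `h` as a function of the state, under `π`. -/
def stepKernel {H S A : ℕ} (M : MDP H S A) (π : Policy H S A) (h : Fin H) :
    Kernel (Fin S) (ℝ × Fin S) :=
  Kernel.ofFunOfCountable fun s => M.outcome h s (π h s)

/-- Append one step, and move to the next state. -/
def pushStep {H S A : ℕ} (π : Policy H S A) {h : ℕ} (hh : h < H)
    (x : (Steps S A h × Fin S) × (ℝ × Fin S)) : Steps S A (h + 1) × Fin S :=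
  (Fin.snoc (α := fun _ => Fin S × Fin A × ℝ) x.1.1 (x.1.2, π ⟨h, hh⟩ x.1.2, x.2.1), x.2.2)

/-- The joint law of the record of the first `h` periods of an episode and of the state that is
reached after them, when `π` is followed in `M`. -/
def prefixLaw {H S A : ℕ} (M : MDP H S A) (π : Policy H S A) :
    (h : ℕ) → h ≤ H → Measure (Steps S A h × Fin S)
  | 0, _ => Measure.dirac (Fin.elim0, M.init)
  | h + 1, hh =>
      ((prefixLaw M π h (Nat.le_of_succ_le hh)) ⊗ₘ
        ((stepKernel M π ⟨h, hh⟩).comap Prod.snd measurable_snd)).map (pushStep π hh)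

/-- The law of an episode of `M` in which `π` is followed. -/
def episodeLaw {H S A : ℕ} (M : MDP H S A) (π : Policy H S A) : Measure (Episode H S A) :=
  (prefixLaw M π H le_rfl).map Prod.fst

/-- An episodic randomized learning algorithm: after `k` episodes it selects the policy of the next
episode as a function of the history and of a fresh seed, drawn from a prespecified law. -/
structure Algorithm (H S A : ℕ) where
  /-- The seeds. -/
  Seed : Type
  [mSeed : MeasurableSpace Seed]
  /-- The law of each seed. -/
  seedLaw : Measure Seed
  [probSeed : IsProbabilityMeasure seedLaw]
  /-- The policy chosen after `k` episodes. -/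
  select : (k : ℕ) → History H S A k → Seed → Policy H S A
  measurable_select : ∀ k, Measurable fun x : History H S A k × Seed => select k x.1 x.2

attribute [instance] Algorithm.mSeed Algorithm.probSeed

/-- The seeds and the records of `K` episodes. -/
abbrev Run {H S A : ℕ} (alg : Algorithm H S A) (K : ℕ) : Type :=
  Fin K → alg.Seed × Episode H S A

/-- The history that a run contains. -/
def Run.history {H S A K : ℕ} {alg : Algorithm H S A} (ω : Run alg K) : History H S A K :=
  fun i => (ω i).2

/-- The history before episode `k`. -/
def Run.historyBefore {H S A K : ℕ} {alg : Algorithm H S A} (ω : Run alg K) (k : Fin K) :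
    History H S A k :=
  fun i => (ω (Fin.castLE k.isLt.le i)).2

/-- The policy used in episode `k` of a run. -/
def Run.policy {H S A K : ℕ} {alg : Algorithm H S A} (ω : Run alg K) (k : Fin K) :
    Policy H S A :=
  alg.select k (ω.historyBefore k) (ω k).1

/-- The law of an episode as a function of the policy. -/
def policyKernel {H S A : ℕ} (M : MDP H S A) : Kernel (Policy H S A) (Episode H S A) :=
  Kernel.ofFunOfCountable fun π => episodeLaw M π

lemma measurable_history {H S A K : ℕ} (alg : Algorithm H S A) :
    Measurable (Run.history : Run alg K → History H S A K) := by
  unfold Run.history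
  fun_prop

/-- The law of episode `k` given the previous episodes and the fresh seed. -/
def nextKernel {H S A : ℕ} (M : MDP H S A) (alg : Algorithm H S A) (k : ℕ) :
    Kernel (Run alg k × alg.Seed) (Episode H S A) :=
  (policyKernel M).comap (fun x => alg.select k x.1.history x.2)
    ((alg.measurable_select k).comp
      (((measurable_history alg).comp measurable_fst).prodMk measurable_snd))

/-- Append one episode to a run. -/
def pushEpisode {H S A k : ℕ} {alg : Algorithm H S A}
    (x : (Run alg k × alg.Seed) × Episode H S A) : Run alg (k + 1) :=
  Fin.snoc (α := fun _ => alg.Seed × Episode H S A) x.1.1 (x.1.2, x.2)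

/-- The law of the interaction of `alg` with `M` over `K` episodes: before each episode a fresh
seed is drawn independently of the past, and then the selected policy is followed in `M`. -/
def runLaw {H S A : ℕ} (M : MDP H S A) (alg : Algorithm H S A) : (K : ℕ) → Measure (Run alg K)
  | 0 => Measure.dirac Fin.elim0
  | k + 1 => (((runLaw M alg k).prod alg.seedLaw) ⊗ₘ nextKernel M alg k).map pushEpisode

/-- The cumulative expected regret over `K` episodes. -/
def regret {H S A : ℕ} (M : MDP H S A) (alg : Algorithm H S A) (K : ℕ) : ℝ :=
  ∫ ω : Run alg K,
    ∑ k : Fin K, (optValue M.tabular 0 M.init - value M.tabular (ω.policy k) 0 M.init)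
      ∂(runLaw M alg K)

/-- The worst-case regret over all MDPs with the given sizes (a supremum in the extended reals). -/
def worstCaseRegret {H S A : ℕ} (alg : Algorithm H S A) (K : ℕ) : EReal :=
  ⨆ M : MDP H S A, ((regret M alg K : ℝ) : EReal)

/-! ### Randomized least squares value iteration -/

/-- The number of past episodes in which `a` was played in `s` at period `h`. -/
def visits {H S A k : ℕ} (D : History H S A k) (h : Fin H) (s : Fin S) (a : Fin A) : ℕ :=
  ∑ i : Fin k, if (D i h).1 = s ∧ (D i h).2.1 = a then 1 else 0

/-- Empirical mean rewards (`0` at a triple that was never visited). -/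
def empReward {H S A k : ℕ} (D : History H S A k) (h : Fin H) (s : Fin S) (a : Fin A) : ℝ :=
  (visits D h s a : ℝ)⁻¹ *
    ∑ i : Fin k, if (D i h).1 = s ∧ (D i h).2.1 = a then (D i h).2.2 else 0

/-- Empirical transition probabilities (`0` at a triple that was never visited, and at the last
period, after which no state is observed). -/
def empTrans {H S A k : ℕ} (D : History H S A k) (h : Fin H) (s : Fin S) (a : Fin A)
    (s' : Fin S) : ℝ :=
  if hh : (h : ℕ) + 1 < H then
    (visits D h s a : ℝ)⁻¹ *
      ∑ i : Fin k,
        if (D i h).1 = s ∧ (D i h).2.1 = a ∧ (D i ⟨h + 1, hh⟩).1 = s' then 1 else 0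
  else 0

/-- The empirical MDP with the noise `w` added to the estimated rewards, where
`w h s a = √(b / (n h s a + 1)) * ξ (h, s, a)`; with standard Gaussian `ξ` this is a centred
Gaussian of variance `b / (n h s a + 1)`. -/
def perturbed {H S A k : ℕ} (b : ℝ) (D : History H S A k) (ξ : Fin H × Fin S × Fin A → ℝ) :
    Tabular H S A where
  P := empTrans D
  R h s a := empReward D h s a + √(b / ((visits D h s a : ℝ) + 1)) * ξ (h, s, a)

lemma measurable_visits {H S A k : ℕ} (h : Fin H) (s : Fin S) (a : Fin A) :
    Measurable fun D : History H S A k => visits D h s a := by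
  unfold visits
  refine Finset.measurable_fun_sum _ fun i _ => Measurable.ite ?_ measurable_const measurable_const
  exact (measurableSet_eq_fun (by fun_prop) (by fun_prop)).inter
    (measurableSet_eq_fun (by fun_prop) (by fun_prop))

lemma measurable_empReward {H S A k : ℕ} (h : Fin H) (s : Fin S) (a : Fin A) :
    Measurable fun D : History H S A k => empReward D h s a := by
  unfold empReward
  refine Measurable.mul ?_ (Finset.measurable_fun_sum _ fun i _ =>
    Measurable.ite ?_ (by fun_prop) measurable_const)
  · exact ((measurable_from_top (f := fun n : ℕ => (n : ℝ))).comp (measurable_visits h s a)).inv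
  · exact (measurableSet_eq_fun (by fun_prop) (by fun_prop)).inter
      (measurableSet_eq_fun (by fun_prop) (by fun_prop))

lemma measurable_empTrans {H S A k : ℕ} (h : Fin H) (s : Fin S) (a : Fin A) (s' : Fin S) :
    Measurable fun D : History H S A k => empTrans D h s a s' := by
  unfold empTrans
  split_ifs with hh
  · refine Measurable.mul ?_ (Finset.measurable_fun_sum _ fun i _ =>
      Measurable.ite ?_ measurable_const measurable_const)
    · exact ((measurable_from_top (f := fun n : ℕ => (n : ℝ))).comp (measurable_visits h s a)).inv
    · exact (measurableSet_eq_fun (by fun_prop) (by fun_prop)).inter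
        ((measurableSet_eq_fun (by fun_prop) (by fun_prop)).inter
          (measurableSet_eq_fun (by fun_prop) (by fun_prop)))
  · exact measurable_const

lemma measurable_value {H S A : ℕ} {X : Type*} [MeasurableSpace X] (m : X → Tabular H S A)
    (hP : ∀ h s a s', Measurable fun x => (m x).P h s a s')
    (hR : ∀ h s a, Measurable fun x => (m x).R h s a) (π : Policy H S A) (h : ℕ) (s : Fin S) :
    Measurable fun x => value (m x) π h s := by
  by_cases hh : h < H
  · have e : (fun x => value (m x) π h s) = fun x => (m x).R ⟨h, hh⟩ s (π ⟨h, hh⟩ s)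
        + ∑ s' : Fin S, (m x).P ⟨h, hh⟩ s (π ⟨h, hh⟩ s) s' * value (m x) π (h + 1) s' := by
      funext x
      rw [value, dif_pos hh]
    rw [e]
    exact (hR _ _ _).add (Finset.measurable_fun_sum _ fun s' _ =>
      (hP _ _ _ _).mul (measurable_value m hP hR π (h + 1) s'))
  · have e : (fun x => value (m x) π h s) = fun _ => 0 := by
      funext x
      rw [value, dif_neg hh]
    rw [e]
    exact measurable_const
termination_by H - h

/-- Randomized least squares value iteration with tuning parameters `β 1, β 2, …`: in episode
number `k + 1` it draws independent Gaussian noise, forms the perturbed empirical MDP with parameter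
`β (k + 1)`, and follows an optimal policy of it.  If there are several optimal policies (an event
of probability zero when the parameters are positive), the rule `pick` selects one. -/
def rlsvi {H S A : ℕ} (β : ℕ → ℝ) (pick : Set (Policy H S A) → Policy H S A) :
    Algorithm H S A where
  Seed := Fin H × Fin S × Fin A → ℝ
  seedLaw := Measure.pi fun _ => gaussianReal 0 1
  select k D ξ := pick {π | IsOptimal (perturbed (β (k + 1)) D ξ) π}
  measurable_select k := by
    have hpick : Measurable pick := measurable_of_finite pick
    refine hpick.comp (measurable_set_iff.2 fun π => ?_)
    have hv : ∀ (π : Policy H S A) (h : ℕ) (s : Fin S),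
        Measurable fun x : History H S A k × (Fin H × Fin S × Fin A → ℝ) =>
          value (perturbed (β (k + 1)) x.1 x.2) π h s := by
      intro π h s
      refine measurable_value (fun x : History H S A k × (Fin H × Fin S × Fin A → ℝ) =>
        perturbed (β (k + 1)) x.1 x.2) ?_ ?_ π h s
      · intro h s a s'
        exact (measurable_empTrans h s a s').comp measurable_fst
      · intro h s a
        have hn : Measurable fun x : History H S A k × (Fin H × Fin S × Fin A → ℝ) =>
            (visits x.1 h s a : ℝ) :=
          ((measurable_from_top (f := fun n : ℕ => (n : ℝ))).comp (measurable_visits h s a)).comp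
            measurable_fst
        have hr : Measurable fun x : History H S A k × (Fin H × Fin S × Fin A → ℝ) =>
            empReward x.1 h s a := (measurable_empReward h s a).comp measurable_fst
        simp only [perturbed]
        fun_prop
    simp only [IsOptimal, Set.mem_ofPred_eq]
    refine Measurable.forall fun h => Measurable.forall fun s => Measurable.forall fun π' => ?_
    exact measurableSet_setOfPred.1 (measurableSet_le (hv π' h s) (hv π h s))

/-! ### The laws above are probability measures -/

lemma measurable_snoc {E : Type*} [MeasurableSpace E] (n : ℕ) :
    Measurable fun x : (Fin n → E) × E => (Fin.snoc (α := fun _ => E) x.1 x.2 : Fin (n + 1) → E) := by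
  refine measurable_pi_iff.2 fun i => ?_
  refine Fin.lastCases ?_ (fun j => ?_) i
  · simpa using measurable_snd
  · simpa [Function.comp_def] using (measurable_pi_apply j).comp (measurable_fst (α := Fin n → E) (β := E))

instance {H S A : ℕ} (M : MDP H S A) (π : Policy H S A) (h : Fin H) :
    IsMarkovKernel (stepKernel M π h) := ⟨fun s => M.isProb h s (π h s)⟩

lemma measurable_pushStep {H S A : ℕ} (π : Policy H S A) {h : ℕ} (hh : h < H) :
    Measurable (pushStep (S := S) (A := A) π hh) := by
  have hπ : Measurable (π ⟨h, hh⟩) := measurable_of_finite _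
  unfold pushStep
  refine Measurable.prodMk ?_ (by fun_prop)
  exact (measurable_snoc h).comp (Measurable.prodMk (by fun_prop) (by fun_prop))

lemma isProbabilityMeasure_prefixLaw {H S A : ℕ} (M : MDP H S A) (π : Policy H S A) :
    ∀ (h : ℕ) (hh : h ≤ H), IsProbabilityMeasure (prefixLaw M π h hh)
  | 0, _ => by unfold prefixLaw; infer_instance
  | h + 1, hh => by
      have := isProbabilityMeasure_prefixLaw M π h (Nat.le_of_succ_le hh)
      unfold prefixLaw
      exact Measure.isProbabilityMeasure_map (measurable_pushStep π hh).aemeasurable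

instance {H S A : ℕ} (M : MDP H S A) (π : Policy H S A) :
    IsProbabilityMeasure (episodeLaw M π) := by
  have := isProbabilityMeasure_prefixLaw M π H le_rfl
  exact Measure.isProbabilityMeasure_map measurable_fst.aemeasurable

instance {H S A : ℕ} (M : MDP H S A) : IsMarkovKernel (policyKernel M) :=
  ⟨fun π => inferInstanceAs (IsProbabilityMeasure (episodeLaw M π))⟩

instance {H S A : ℕ} (M : MDP H S A) (alg : Algorithm H S A) (k : ℕ) :
    IsMarkovKernel (nextKernel M alg k) := by
  unfold nextKernel
  infer_instance

lemma measurable_pushEpisode {H S A k : ℕ} (alg : Algorithm H S A) :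
    Measurable (pushEpisode (k := k) (alg := alg)) := by
  unfold pushEpisode
  exact (measurable_snoc k).comp (Measurable.prodMk (by fun_prop) (by fun_prop))

instance isProbabilityMeasure_runLaw {H S A : ℕ} (M : MDP H S A) (alg : Algorithm H S A) :
    ∀ K : ℕ, IsProbabilityMeasure (runLaw M alg K)
  | 0 => by unfold runLaw; infer_instance
  | k + 1 => by
      have := isProbabilityMeasure_runLaw M alg k
      unfold runLaw
      exact Measure.isProbabilityMeasure_map (measurable_pushEpisode alg).aemeasurable

end RVF

end

/-!
The proof bounds the regret of an episode by the value, in the empirical model, of an exploration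
bonus proportional to `1 / √(n + 1)`, where `n` counts the visits to a triple, and then sums the
bonuses over the episodes. The bonus covers both the noise and the estimation errors.

*One episode.* Fix a history on which the empirical model is accurate (`IsGood`).

* Optimism (`optimismProb_le_value_perturbed`): for an optimal policy `π₀` of the true model, the
  perturbed empirical value of `π₀` is its true value plus a centred Gaussian minus an estimation
  error. Both are linear in the occupation weights of `π₀` in the empirical model, and `β` is chosen
  so that the error is at most three standard deviations of the Gaussian. Hence the optimal
  perturbed value is at least the true optimal value with a constant probability.
* Let `v` be the optimal value of the empirical model with rewards lowered by the largest plausible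
  noise. Under optimism, the optimal value exceeds `v` by at most the empirical value `U` of the
  bonus under the selected policy, so Markov's inequality bounds this deterministic difference by a
  constant times the mean of `U` (`lintegral_le_of_optimism`). On the other hand `v` is at most the
  perturbed value of the selected policy, which exceeds its true value by at most `U`
  (`value_perturbed_le`). Together, the mean regret is at most a constant times the mean of `U`
  (`lintegral_gap_le`). Only true value functions, which lie in `[0, H]`, are multiplied by
  `P̂ - P` in this argument; the perturbed ones are unbounded.
* `U` is a value under the empirical transitions. Since `P̂ ≤ (1 + 1/H) P + O(H log / n)`
  coordinatewise, it is at most three times the corresponding value under the true transitions plus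
  a second-order term of order `1 / n` (`value_bonus_le`).

*All episodes.* The history is good with high probability because the exponentials of suitably
centred sums over the visits to a triple are supermartingales, whatever the algorithm does
(`expectHistory_exp_obsSum_le`). Telescoping the potentials `2 √n` and `2 log (n + 1)` over the
episodes shows that the terms of order `1 / √n` add up to `H √(S A K)` and those of order `1 / n` to
`H S A log K`. The second-order contribution `b` does not grow with `K` beyond logarithms; combined
with the trivial bound `H K` it costs at most `√(H K b)`, which is within the claimed rate
(`min_bound_le`). A multiplicative comparison of `P̂` with `P` is needed here: the product of the
supremum of `U` with an additive bound on `P̂ - P` is of first order `1 / √n`, and too large by a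
power of `H`.
-/

noncomputable section

namespace RVF

/-! ### Bellman recursion and comparison of value functions -/

section Tabular

variable {H S A : ℕ}

lemma value_of_lt (m : Tabular H S A) (π : Policy H S A) {h : ℕ} (hh : h < H) (s : Fin S) :
    value m π h s = m.R ⟨h, hh⟩ s (π ⟨h, hh⟩ s)
      + ∑ s' : Fin S, m.P ⟨h, hh⟩ s (π ⟨h, hh⟩ s) s' * value m π (h + 1) s' := by
  rw [value, dif_pos hh]

lemma value_of_le (m : Tabular H S A) (π : Policy H S A) {h : ℕ} (hh : H ≤ h) (s : Fin S) :
    value m π h s = 0 := by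
  rw [value, dif_neg (by omega)]

/-- Induction from the last period backwards. -/
@[elab_as_elim]
lemma backward_induction {p : ℕ → Prop} (h0 : ∀ h, H ≤ h → p h)
    (h1 : ∀ h, h < H → p (h + 1) → p h) (h : ℕ) : p h := by
  by_cases hh : h < H
  · exact h1 h hh (backward_induction h0 h1 (h + 1))
  · exact h0 h (by omega)
termination_by H - h

/-- A function that dominates its own Bellman update dominates the value function. -/
lemma value_le_of_bellman (m : Tabular H S A) (π : Policy H S A) (F : ℕ → Fin S → ℝ)
    (hP : ∀ h s a s', 0 ≤ m.P h s a s') (hF : ∀ h s, H ≤ h → 0 ≤ F h s)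
    (hB : ∀ (h : ℕ) (hh : h < H) (s : Fin S), m.R ⟨h, hh⟩ s (π ⟨h, hh⟩ s)
      + ∑ s' : Fin S, m.P ⟨h, hh⟩ s (π ⟨h, hh⟩ s) s' * F (h + 1) s' ≤ F h s) (h : ℕ) :
    ∀ s, value m π h s ≤ F h s := by
  refine backward_induction (H := H) ?_ ?_ h
  · intro h hh s
    rw [value_of_le m π hh]; exact hF h s hh
  · intro h hh ih s
    rw [value_of_lt m π hh]
    refine le_trans ?_ (hB h hh s)
    gcongr with s' _
    · exact hP _ _ _ _
    · exact ih s'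

/-- A function dominated by its own Bellman update is dominated by the value function. -/
lemma le_value_of_bellman (m : Tabular H S A) (π : Policy H S A) (F : ℕ → Fin S → ℝ)
    (hP : ∀ h s a s', 0 ≤ m.P h s a s') (hF : ∀ h s, H ≤ h → F h s ≤ 0)
    (hB : ∀ (h : ℕ) (hh : h < H) (s : Fin S), F h s ≤ m.R ⟨h, hh⟩ s (π ⟨h, hh⟩ s)
      + ∑ s' : Fin S, m.P ⟨h, hh⟩ s (π ⟨h, hh⟩ s) s' * F (h + 1) s') (h : ℕ) :
    ∀ s, F h s ≤ value m π h s := by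
  refine backward_induction (H := H) ?_ ?_ h
  · intro h hh s
    rw [value_of_le m π hh]; exact hF h s hh
  · intro h hh ih s
    rw [value_of_lt m π hh]
    refine le_trans (hB h hh s) ?_
    gcongr with s' _
    · exact hP _ _ _ _
    · exact ih s'

lemma value_nonneg (m : Tabular H S A) (π : Policy H S A)
    (hP : ∀ h s a s', 0 ≤ m.P h s a s') (hR : ∀ h s a, 0 ≤ m.R h s a) (h : ℕ) (s : Fin S) :
    0 ≤ value m π h s :=
  le_value_of_bellman m π (fun _ _ => 0) hP (fun _ _ _ => le_rfl)
    (fun h hh s => by simpa using hR _ _ _) h s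

lemma value_mono_reward {P : Fin H → Fin S → Fin A → Fin S → ℝ} {R R' : Fin H → Fin S → Fin A → ℝ}
    (π : Policy H S A) (hP : ∀ h s a s', 0 ≤ P h s a s') (hR : ∀ h s a, R h s a ≤ R' h s a)
    (h : ℕ) (s : Fin S) : value ⟨P, R⟩ π h s ≤ value ⟨P, R'⟩ π h s := by
  refine value_le_of_bellman ⟨P, R⟩ π (fun h s => value ⟨P, R'⟩ π h s) hP
    (fun h s hh => (value_of_le _ π hh s).ge) (fun h hh s => ?_) h s
  rw [value_of_lt ⟨P, R'⟩ π hh]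
  simpa using hR _ _ _

lemma value_add_reward (P : Fin H → Fin S → Fin A → Fin S → ℝ) (R R' : Fin H → Fin S → Fin A → ℝ)
    (π : Policy H S A) (h : ℕ) : ∀ s,
    value ⟨P, fun h s a => R h s a + R' h s a⟩ π h s
      = value ⟨P, R⟩ π h s + value ⟨P, R'⟩ π h s := by
  refine backward_induction (H := H) ?_ ?_ h
  · intro h hh s
    simp [value_of_le _ π hh]
  · intro h hh ih s
    simp only [value_of_lt _ π hh, ih, mul_add, Finset.sum_add_distrib]
    ring

lemma value_smul_reward (P : Fin H → Fin S → Fin A → Fin S → ℝ) (c : ℝ)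
    (R : Fin H → Fin S → Fin A → ℝ) (π : Policy H S A) (h : ℕ) : ∀ s,
    value ⟨P, fun h s a => c * R h s a⟩ π h s = c * value ⟨P, R⟩ π h s := by
  refine backward_induction (H := H) ?_ ?_ h
  · intro h hh s
    simp [value_of_le _ π hh]
  · intro h hh ih s
    simp only [value_of_lt _ π hh, ih, mul_add, Finset.mul_sum]
    congr 1
    exact Finset.sum_congr rfl fun _ _ => by ring

/-- For substochastic transitions, rewards bounded by `c` give values bounded by `c` times the
number of remaining periods. -/
lemma value_le_mul_of_substochastic (m : Tabular H S A) (π : Policy H S A) {c : ℝ} (hc : 0 ≤ c)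
    (hP : ∀ h s a s', 0 ≤ m.P h s a s') (hP1 : ∀ h s a, ∑ s', m.P h s a s' ≤ 1)
    (hR : ∀ h s a, m.R h s a ≤ c) (h : ℕ) (s : Fin S) :
    value m π h s ≤ c * ((H - h : ℕ) : ℝ) := by
  refine value_le_of_bellman m π (fun h _ => c * ((H - h : ℕ) : ℝ)) hP
    (fun h s _ => by positivity) (fun h hh s => ?_) h s
  rw [← Finset.sum_mul]
  have e : ((H - h : ℕ) : ℝ) = ((H - (h + 1) : ℕ) : ℝ) + 1 := by
    rw [show H - h = (H - (h + 1)) + 1 by omega]; push_cast; ring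
  have h1 := hR ⟨h, hh⟩ s (π ⟨h, hh⟩ s)
  have h2 : (∑ s', m.P ⟨h, hh⟩ s (π ⟨h, hh⟩ s) s') * (c * ((H - (h + 1) : ℕ) : ℝ))
      ≤ 1 * (c * ((H - (h + 1) : ℕ) : ℝ)) :=
    mul_le_mul_of_nonneg_right (hP1 _ _ _) (by positivity)
  rw [e]
  linarith

/-- The value of `π` from `(h, s)` is a nonnegative linear functional of the rewards that `π`
collects; the coefficients `d` are the occupation weights of `π`. -/
lemma exists_occupancy (P : Fin H → Fin S → Fin A → Fin S → ℝ) (hP : ∀ h s a s', 0 ≤ P h s a s')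
    (π : Policy H S A) (h : ℕ) : ∀ s, ∃ d : Fin H → Fin S → ℝ, (∀ i t, 0 ≤ d i t) ∧
      ∀ R : Fin H → Fin S → Fin A → ℝ, value ⟨P, R⟩ π h s = ∑ i, ∑ t, d i t * R i t (π i t) := by
  refine backward_induction (H := H) ?_ ?_ h
  · intro h hh s
    exact ⟨fun _ _ => 0, fun _ _ => le_rfl, fun R => by simp [value_of_le _ π hh]⟩
  · intro h hh ih s
    choose d hd0 hd using ih
    refine ⟨fun i t => (if i = ⟨h, hh⟩ ∧ t = s then 1 else 0)
      + ∑ s', P ⟨h, hh⟩ s (π ⟨h, hh⟩ s) s' * d s' i t, fun i t => ?_, fun R => ?_⟩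
    · have : 0 ≤ ∑ s', P ⟨h, hh⟩ s (π ⟨h, hh⟩ s) s' * d s' i t :=
        Finset.sum_nonneg fun s' _ => mul_nonneg (hP _ _ _ _) (hd0 _ _ _)
      dsimp only
      split_ifs <;> linarith
    · rw [value_of_lt _ π hh]
      simp only [hd, add_mul, Finset.sum_add_distrib, Finset.sum_mul, Finset.mul_sum]
      congr 1
      · rw [Finset.sum_eq_single ⟨h, hh⟩, Finset.sum_eq_single s] <;> simp +contextual
      · rw [Finset.sum_comm]
        refine Finset.sum_congr rfl fun i _ => ?_
        rw [Finset.sum_comm]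
        exact Finset.sum_congr rfl fun t _ => Finset.sum_congr rfl fun s' _ => by ring

lemma value_congr_policy (m : Tabular H S A) {π π' : Policy H S A} (h : ℕ) :
    (∀ i : Fin H, h ≤ i → π i = π' i) → ∀ s, value m π h s = value m π' h s := by
  refine backward_induction (H := H) ?_ ?_ h
  · intro h hh _ s
    simp [value_of_le _ _ hh]
  · intro h hh ih hπ s
    have e := hπ ⟨h, hh⟩ le_rfl
    have := ih fun i hi => hπ i (by omega)
    simp only [value_of_lt _ _ hh, this, e]

/-- Backward induction produces a policy that is optimal at every period and state. -/
lemma exists_isOptimal [NeZero A] (m : Tabular H S A) (hP : ∀ h s a s', 0 ≤ m.P h s a s') :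
    ∃ π, IsOptimal m π := by
  suffices key : ∀ h : ℕ, ∃ π : Policy H S A, ∀ h' ≥ h, ∀ s π', value m π' h' s ≤ value m π h' s by
    obtain ⟨π, hπ⟩ := key 0
    exact ⟨π, fun h s π' => hπ h (Nat.zero_le h) s π'⟩
  refine backward_induction (H := H) ?_ ?_
  · intro h hh
    exact ⟨fun _ _ => 0, fun h' hh' s π' => by simp [value_of_le _ _ (hh.trans hh')]⟩
  · intro h hh ih
    obtain ⟨π, hπ⟩ := ih
    have : ∀ s, ∃ a : Fin A, ∀ a' : Fin A,
        m.R ⟨h, hh⟩ s a' + ∑ s', m.P ⟨h, hh⟩ s a' s' * value m π (h + 1) s'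
        ≤ m.R ⟨h, hh⟩ s a + ∑ s', m.P ⟨h, hh⟩ s a s' * value m π (h + 1) s' := fun s =>
      Finite.exists_max _
    choose g hg using this
    let π₂ : Policy H S A := Function.update π ⟨h, hh⟩ g
    have e : ∀ h' ≥ h + 1, ∀ s, value m π₂ h' s = value m π h' s := fun h' hh' s => by
      refine value_congr_policy m h' (fun i hi => ?_) s
      refine Function.update_of_ne (fun hc => ?_) _ _
      rw [hc] at hi
      simp only at hi
      omega
    refine ⟨π₂, fun h' hh' s π' => ?_⟩
    rcases eq_or_lt_of_le hh' with rfl | hlt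
    · rw [value_of_lt _ _ hh, value_of_lt m π₂ hh]
      have e2 : π₂ ⟨h, hh⟩ s = g s := by simp [π₂]
      simp only [e2, e (h + 1) le_rfl]
      refine le_trans ?_ (hg s (π' ⟨h, hh⟩ s))
      gcongr with s' _
      · exact hP _ _ _ _
      · exact hπ _ le_rfl _ _
    · rw [e h' hlt]
      exact hπ h' hlt s π'

end Tabular

/-! ### The laws of an episode and of a run -/

section Laws

open scoped ENNReal

variable {H S A : ℕ}

lemma lintegral_prefixLaw_succ (M : MDP H S A) (π : Policy H S A) {h : ℕ} (hh : h + 1 ≤ H)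
    {F : Steps S A (h + 1) × Fin S → ℝ≥0∞} (hF : Measurable F) :
    ∫⁻ x, F x ∂(prefixLaw M π (h + 1) hh)
      = ∫⁻ y, ∫⁻ z, F (pushStep π hh (y, z)) ∂(M.outcome ⟨h, hh⟩ y.2 (π ⟨h, hh⟩ y.2))
        ∂(prefixLaw M π h (Nat.le_of_succ_le hh)) := by
  have := isProbabilityMeasure_prefixLaw M π h (Nat.le_of_succ_le hh)
  rw [prefixLaw, lintegral_map hF (measurable_pushStep π hh),
    Measure.lintegral_compProd (f := fun x => F (pushStep π hh x))
      (hF.comp (measurable_pushStep π hh))]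
  rfl

/-- The first `h` records of a longer prefix, together with the state in which period `h` starts,
have the law `prefixLaw M π h`. -/
lemma lintegral_prefixLaw_restrict (M : MDP H S A) (π : Policy H S A) {h : ℕ}
    {F : Steps S A h × Fin S → ℝ≥0∞} (hF : Measurable F) (n : ℕ) (hn : h < n) (hH : n ≤ H) :
    ∫⁻ x, F (fun i => x.1 (Fin.castLE hn.le i), (x.1 ⟨h, hn⟩).1) ∂(prefixLaw M π n hH)
      = ∫⁻ y, F y ∂(prefixLaw M π h (hn.le.trans hH)) := by
  induction n, hn using Nat.le_induction with
  | base =>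
    rw [lintegral_prefixLaw_succ M π hH (by fun_prop)]
    refine lintegral_congr fun y => ?_
    have e : ∀ z, F (fun i => (pushStep π hH (y, z)).1 (Fin.castLE (Nat.le_succ h) i),
        ((pushStep π hH (y, z)).1 ⟨h, Nat.lt_succ_self h⟩).1) = F y := fun z => by
      congr 1
      refine Prod.ext ?_ ?_
      · funext i
        exact Fin.snoc_castSucc (α := fun _ => Fin S × Fin A × ℝ) _ _ i
      · change (Fin.snoc (α := fun _ => Fin S × Fin A × ℝ) y.1 _ (Fin.last h)).1 = y.2
        rw [Fin.snoc_last]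
    simp only [Nat.succ_eq_add_one] at e ⊢
    simp [e]
  | succ n hn ih =>
    have hn' : h < n := hn
    rw [lintegral_prefixLaw_succ M π hH (by fun_prop), ← ih (Nat.le_of_succ_le hH)]
    refine lintegral_congr fun y => ?_
    have e : ∀ z, F (fun i =>
        (pushStep π hH (y, z)).1 (Fin.castLE (hn'.le.trans (Nat.le_succ n)) i),
        ((pushStep π hH (y, z)).1 ⟨h, hn'.trans (Nat.lt_succ_self n)⟩).1)
        = F (fun i => y.1 (Fin.castLE hn'.le i), (y.1 ⟨h, hn'⟩).1) := fun z => by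
      congr 1
      refine Prod.ext ?_ ?_
      · funext i
        exact Fin.snoc_castSucc (α := fun _ => Fin S × Fin A × ℝ) _ _ (Fin.castLE hn'.le i)
      · exact congrArg Prod.fst
          (Fin.snoc_castSucc (α := fun _ => Fin S × Fin A × ℝ) _ _ (⟨h, hn'⟩ : Fin n))
    simp [e]

lemma lintegral_episodeLaw (M : MDP H S A) (π : Policy H S A) {F : Episode H S A → ℝ≥0∞}
    (hF : Measurable F) :
    ∫⁻ e, F e ∂(episodeLaw M π) = ∫⁻ x, F x.1 ∂(prefixLaw M π H le_rfl) := by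
  rw [episodeLaw, lintegral_map hF measurable_fst]

/-- The state that follows period `h` of an episode. After the last period no state is recorded,
and the state of the last period itself stands in for it. -/
def nextState (e : Episode H S A) (h : Fin H) : Fin S :=
  if hh : (h : ℕ) + 1 < H then (e ⟨h + 1, hh⟩).1 else (e h).1

@[fun_prop]
lemma measurable_nextState (h : Fin H) :
    Measurable fun e : Episode H S A => nextState e h := by
  unfold nextState
  split_ifs <;> fun_prop

/-- The record of period `h` together with the following state: given the past, reward and next
state are drawn from `M.outcome`. In the last period this holds for functions that ignore the next
state. -/
lemma lintegral_transition (M : MDP H S A) (π : Policy H S A) (h : Fin H)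
    {F : Fin S × Fin A × ℝ × Fin S → ℝ≥0∞} (hF : Measurable F)
    (hlast : (h : ℕ) + 1 < H ∨ ∀ s a r t t', F (s, a, r, t) = F (s, a, r, t')) :
    ∫⁻ e, F ((e h).1, (e h).2.1, (e h).2.2, nextState e h) ∂(episodeLaw M π)
      = ∫⁻ y, ∫⁻ z, F (y.2, π h y.2, z) ∂(M.outcome h y.2 (π h y.2))
        ∂(prefixLaw M π h h.isLt.le) := by
  rw [lintegral_episodeLaw M π (by fun_prop)]
  obtain ⟨h, hh⟩ := h
  by_cases hl : h + 1 < H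
  · have key := lintegral_prefixLaw_restrict M π (h := h + 1)
      (F := fun x => F ((x.1 (Fin.last h)).1, (x.1 (Fin.last h)).2.1, (x.1 (Fin.last h)).2.2, x.2))
      (by fun_prop) H hl le_rfl
    rw [lintegral_prefixLaw_succ M π hh (by fun_prop)] at key
    simp only [nextState, hl, dif_pos]
    refine Eq.trans ?_ (key.trans ?_)
    · rfl
    · simp [pushStep]
  · obtain rfl : H = h + 1 := by omega
    have hc : ∀ s a r t t', F (s, a, r, t) = F (s, a, r, t') := hlast.resolve_left hl
    rw [lintegral_prefixLaw_succ M π le_rfl (by fun_prop)]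
    refine lintegral_congr fun y => lintegral_congr fun z => ?_
    have e : (pushStep π (le_refl (h + 1)) (y, z)).1 ⟨h, hh⟩ = (y.2, π ⟨h, hh⟩ y.2, z.1) :=
      Fin.snoc_last (α := fun _ => Fin S × Fin A × ℝ) _ _
    rw [e]
    exact hc _ _ _ _ _

lemma lintegral_ofReal_finite_state {μ : Measure (ℝ × Fin S)} [IsProbabilityMeasure μ]
    (v : Fin S → ℝ) (hv : ∀ s, 0 ≤ v s) :
    ∫⁻ z, ENNReal.ofReal (v z.2) ∂μ = ENNReal.ofReal (∑ s', μ.real {x | x.2 = s'} * v s') := by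
  have hm : Measurable fun z : ℝ × Fin S => z.2 := measurable_snd
  rw [← lintegral_map (f := fun s => ENNReal.ofReal (v s)) (measurable_of_finite _) hm,
    lintegral_fintype, ENNReal.ofReal_sum_of_nonneg fun s _ => mul_nonneg measureReal_nonneg (hv s)]
  refine Finset.sum_congr rfl fun s _ => ?_
  rw [Measure.map_apply hm (measurableSet_singleton s), ENNReal.ofReal_mul measureReal_nonneg,
    ofReal_measureReal, mul_comm]
  rfl

/-- The value of a policy for nonnegative rewards is the expected sum of rewards along an
episode. -/
lemma ofReal_value_eq_sum_lintegral (M : MDP H S A) (π : Policy H S A)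
    (g : Fin H → Fin S → Fin A → ℝ) (hg : ∀ h s a, 0 ≤ g h s a) :
    ENNReal.ofReal (value ⟨M.tabular.P, g⟩ π 0 M.init)
      = ∑ h : Fin H, ∫⁻ e, ENNReal.ofReal (g h (e h).1 (e h).2.1) ∂(episodeLaw M π) := by
  have hP : ∀ h s a s', 0 ≤ M.tabular.P h s a s' := fun h s a s' => measureReal_nonneg
  have hv : ∀ h s, 0 ≤ value ⟨M.tabular.P, g⟩ π h s := value_nonneg _ π hP hg
  have key : ∀ (n : ℕ) (hn : n ≤ H), ENNReal.ofReal (value ⟨M.tabular.P, g⟩ π 0 M.init)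
      = ∑ i : Fin n, ∫⁻ y, ENNReal.ofReal (g (Fin.castLE hn i) y.2 (π (Fin.castLE hn i) y.2))
          ∂(prefixLaw M π i (i.isLt.le.trans hn))
        + ∫⁻ y, ENNReal.ofReal (value ⟨M.tabular.P, g⟩ π n y.2) ∂(prefixLaw M π n hn) := by
    intro n
    induction n with
    | zero =>
      intro hn
      have hm : Measurable fun y : Steps S A 0 × Fin S =>
          ENNReal.ofReal (value ⟨M.tabular.P, g⟩ π 0 y.2) :=
        (measurable_of_finite fun s => ENNReal.ofReal (value ⟨M.tabular.P, g⟩ π 0 s)).comp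
          measurable_snd
      simp [prefixLaw, lintegral_dirac' _ hm]
    | succ n ih =>
      intro hn
      rw [ih (Nat.le_of_succ_le hn), Fin.sum_univ_castSucc, add_assoc]
      congr 1
      have hm : Measurable fun y : Steps S A (n + 1) × Fin S =>
          ENNReal.ofReal (value ⟨M.tabular.P, g⟩ π (n + 1) y.2) :=
        (measurable_of_finite fun s => ENNReal.ofReal (value ⟨M.tabular.P, g⟩ π (n + 1) s)).comp
          measurable_snd
      have hm' : Measurable fun y : Steps S A n × Fin S =>
          ENNReal.ofReal (g ⟨n, hn⟩ y.2 (π ⟨n, hn⟩ y.2)) :=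
        (measurable_of_finite fun s => ENNReal.ofReal (g ⟨n, hn⟩ s (π ⟨n, hn⟩ s))).comp
          measurable_snd
      rw [lintegral_prefixLaw_succ M π hn hm]
      refine Eq.trans ?_ (lintegral_add_left hm' _)
      refine lintegral_congr fun y => ?_
      have e := lintegral_ofReal_finite_state (μ := M.outcome ⟨n, hn⟩ y.2 (π ⟨n, hn⟩ y.2))
        (fun s => value ⟨M.tabular.P, g⟩ π (n + 1) s) (hv (n + 1))
      rw [value_of_lt _ π hn, ENNReal.ofReal_add (hg _ _ _)
        (Finset.sum_nonneg fun s' _ => mul_nonneg (hP _ _ _ _) (hv _ _))]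
      simp only [pushStep]
      rw [e]
      rfl
  rw [key H le_rfl]
  have z : ∀ s, value ⟨M.tabular.P, g⟩ π H s = 0 := fun s => value_of_le _ π le_rfl s
  simp only [z, ENNReal.ofReal_zero, lintegral_zero, add_zero]
  refine Finset.sum_congr rfl fun h _ => ?_
  have := lintegral_transition M π h (F := fun x => ENNReal.ofReal (g h x.1 x.2.1)) (by
    exact (measurable_of_finite fun x : Fin S × Fin A => ENNReal.ofReal (g h x.1 x.2)).comp
      (f := fun x : Fin S × Fin A × ℝ × Fin S => (x.1, x.2.1)) (by fun_prop))
    (Or.inr fun _ _ _ _ _ => rfl)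
  rw [this]
  refine lintegral_congr fun y => ?_
  simp

lemma lintegral_runLaw_succ (M : MDP H S A) (alg : Algorithm H S A) (k : ℕ)
    {F : Run alg (k + 1) → ℝ≥0∞} (hF : Measurable F) :
    ∫⁻ ω, F ω ∂(runLaw M alg (k + 1))
      = ∫⁻ ω, ∫⁻ ξ, ∫⁻ e, F (pushEpisode ((ω, ξ), e))
          ∂(episodeLaw M (alg.select k ω.history ξ)) ∂alg.seedLaw ∂(runLaw M alg k) := by
  have hF' : Measurable fun x => F (pushEpisode x) :=
    hF.comp (measurable_pushEpisode (k := k) alg)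
  rw [runLaw, lintegral_map hF (measurable_pushEpisode alg), Measure.lintegral_compProd hF',
    lintegral_prod _ (Measurable.lintegral_kernel_prod_right' hF').aemeasurable]
  rfl

lemma history_pushEpisode {alg : Algorithm H S A} {k : ℕ} (ω : Run alg k) (ξ : alg.Seed)
    (e : Episode H S A) : (pushEpisode ((ω, ξ), e)).history
      = (Fin.snoc (α := fun _ => Episode H S A) ω.history e : History H S A (k + 1)) := by
  funext i
  refine Fin.lastCases ?_ (fun j => ?_) i
  · simp [pushEpisode, Run.history]
  · simp [pushEpisode, Run.history]

lemma policy_pushEpisode_castSucc {alg : Algorithm H S A} {k : ℕ} (ω : Run alg k) (ξ : alg.Seed)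
    (e : Episode H S A) (i : Fin k) :
    (pushEpisode ((ω, ξ), e)).policy i.castSucc = ω.policy i := by
  have e1 : ∀ j : Fin k, (pushEpisode ((ω, ξ), e)) j.castSucc = ω j := fun j => by
    simp [pushEpisode]
  have e2 : Run.historyBefore (pushEpisode ((ω, ξ), e)) i.castSucc = ω.historyBefore i := by
    funext j
    exact congrArg Prod.snd (e1 (Fin.castLE i.isLt.le j))
  unfold Run.policy
  rw [e1, e2]
  rfl

lemma policy_pushEpisode_last {alg : Algorithm H S A} {k : ℕ} (ω : Run alg k) (ξ : alg.Seed)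
    (e : Episode H S A) :
    (pushEpisode ((ω, ξ), e)).policy (Fin.last k) = alg.select k ω.history ξ := by
  have e2 : Run.historyBefore (pushEpisode ((ω, ξ), e)) (Fin.last k) = ω.history := by
    funext j
    have : (pushEpisode ((ω, ξ), e)) j.castSucc = ω j := by simp [pushEpisode]
    exact congrArg Prod.snd this
  have e3 : (pushEpisode ((ω, ξ), e)) (Fin.last k) = (ξ, e) := by simp [pushEpisode]
  unfold Run.policy
  rw [e3, e2]
  rfl

lemma measurable_policy {alg : Algorithm H S A} {K : ℕ} (k : Fin K) :
    Measurable fun ω : Run alg K => ω.policy k := by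
  unfold Run.policy Run.historyBefore
  exact (alg.measurable_select k).comp (f := fun ω : Run alg K =>
    ((fun i => (ω (Fin.castLE k.isLt.le i)).2 : History H S A k), (ω k).1)) (by fun_prop)

/-- The expectation, over the first `k` episodes and a fresh seed, of a function of the history and
of the policy selected for the next episode. -/
def expectNext (M : MDP H S A) (alg : Algorithm H S A) (k : ℕ)
    (F : History H S A k → Policy H S A → ℝ≥0∞) : ℝ≥0∞ :=
  ∫⁻ ω, ∫⁻ ξ, F ω.history (alg.select k ω.history ξ) ∂alg.seedLaw ∂(runLaw M alg k)

/-- The expectation of a function of the history of the first `k` episodes. -/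
def expectHistory (M : MDP H S A) (alg : Algorithm H S A) (k : ℕ)
    (F : History H S A k → ℝ≥0∞) : ℝ≥0∞ :=
  ∫⁻ ω, F ω.history ∂(runLaw M alg k)

/-- The expectation of a function of the policies splits into the contributions of the episodes. -/
lemma lintegral_sum_policy (M : MDP H S A) (alg : Algorithm H S A) (f : Policy H S A → ℝ≥0∞)
    (K : ℕ) : ∫⁻ ω, ∑ k : Fin K, f (ω.policy k) ∂(runLaw M alg K)
      = ∑ k ∈ Finset.range K, expectNext M alg k fun _ π => f π := by
  have hf : Measurable f := measurable_of_finite f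
  induction K with
  | zero => simp
  | succ K ih =>
    have hm : ∀ K : ℕ, Measurable fun ω : Run alg K => ∑ k : Fin K, f (ω.policy k) := fun K =>
      Finset.measurable_sum _ fun k _ => hf.comp (measurable_policy k)
    rw [lintegral_runLaw_succ M alg K (hm (K + 1)), Finset.sum_range_succ, ← ih]
    unfold expectNext
    rw [← lintegral_add_left (hm K)]
    refine lintegral_congr fun ω => ?_
    have hm' : Measurable fun ξ => f (alg.select K ω.history ξ) :=
      hf.comp ((alg.measurable_select K).comp (measurable_const.prodMk measurable_id))
    simp only [Fin.sum_univ_castSucc, policy_pushEpisode_castSucc, policy_pushEpisode_last,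
      lintegral_const, measure_univ, mul_one]
    rw [lintegral_add_left measurable_const]
    simp

lemma expectHistory_succ (M : MDP H S A) (alg : Algorithm H S A) (k : ℕ)
    {F : History H S A (k + 1) → ℝ≥0∞} (hF : Measurable F) :
    expectHistory M alg (k + 1) F = expectNext M alg k fun D π =>
      ∫⁻ e, F (Fin.snoc (α := fun _ => Episode H S A) D e) ∂(episodeLaw M π) := by
  unfold expectHistory expectNext
  rw [lintegral_runLaw_succ M alg k (F := fun ω => F ω.history) (hF.comp (measurable_history alg))]
  simp only [history_pushEpisode]

lemma expectNext_mono (M : MDP H S A) (alg : Algorithm H S A) (k : ℕ)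
    {F G : History H S A k → Policy H S A → ℝ≥0∞} (h : ∀ D π, F D π ≤ G D π) :
    expectNext M alg k F ≤ expectNext M alg k G :=
  lintegral_mono fun _ => lintegral_mono fun _ => h _ _

lemma expectNext_history (M : MDP H S A) (alg : Algorithm H S A) (k : ℕ)
    (F : History H S A k → ℝ≥0∞) :
    expectNext M alg k (fun D _ => F D) = expectHistory M alg k F := by
  simp [expectNext, expectHistory]

lemma measurable_expectNext_inner (alg : Algorithm H S A) (k : ℕ)
    {F : History H S A k → Policy H S A → ℝ≥0∞} (hF : ∀ π, Measurable fun D => F D π) :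
    Measurable fun x : Run alg k × alg.Seed => F x.1.history (alg.select k x.1.history x.2) := by
  have hsel : Measurable fun x : Run alg k × alg.Seed => alg.select k x.1.history x.2 :=
    (alg.measurable_select k).comp
      (((measurable_history alg).comp measurable_fst).prodMk measurable_snd)
  have hF' : Measurable fun y : Policy H S A × History H S A k => F y.2 y.1 :=
    measurable_from_prod_countable_right hF
  exact hF'.comp (hsel.prodMk ((measurable_history alg).comp measurable_fst))

lemma expectNext_add (M : MDP H S A) (alg : Algorithm H S A) (k : ℕ)
    {F : History H S A k → Policy H S A → ℝ≥0∞} (hF : ∀ π, Measurable fun D => F D π)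
    (G : History H S A k → Policy H S A → ℝ≥0∞) :
    expectNext M alg k (fun D π => F D π + G D π)
      = expectNext M alg k F + expectNext M alg k G := by
  have hm := measurable_expectNext_inner alg k hF
  unfold expectNext
  rw [← lintegral_add_left hm.lintegral_prod_right']
  refine lintegral_congr fun ω => ?_
  rw [← lintegral_add_left]
  exact hm.comp (measurable_const.prodMk measurable_id)

lemma expectNext_const_mul (M : MDP H S A) (alg : Algorithm H S A) (k : ℕ) (c : ℝ≥0∞)
    {F : History H S A k → Policy H S A → ℝ≥0∞} (hF : ∀ π, Measurable fun D => F D π) :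
    expectNext M alg k (fun D π => c * F D π) = c * expectNext M alg k F := by
  have hm := measurable_expectNext_inner alg k hF
  unfold expectNext
  rw [← lintegral_const_mul _ hm.lintegral_prod_right']
  refine lintegral_congr fun ω => ?_
  rw [← lintegral_const_mul]
  exact hm.comp (measurable_const.prodMk measurable_id)

/-- If adding an episode increases `Φ` by at least `g` in mean, then the accumulated mean of `g` is
at most the final mean of `Φ`. -/
lemma sum_expectNext_le_of_potential (M : MDP H S A) (alg : Algorithm H S A)
    (Φ : (k : ℕ) → History H S A k → ℝ≥0∞) (hΦ : ∀ k, Measurable (Φ k))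
    (g : (k : ℕ) → History H S A k → Policy H S A → ℝ≥0∞)
    (hstep : ∀ k D π, Φ k D + g k D π
      ≤ ∫⁻ e, Φ (k + 1) (Fin.snoc (α := fun _ => Episode H S A) D e) ∂(episodeLaw M π)) (K : ℕ) :
    ∑ k ∈ Finset.range K, expectNext M alg k (g k) ≤ expectHistory M alg K (Φ K) := by
  induction K with
  | zero => simp
  | succ K ih =>
    rw [Finset.sum_range_succ, expectHistory_succ M alg K (hΦ (K + 1))]
    refine le_trans ?_ (expectNext_mono M alg K (hstep K))
    rw [expectNext_add M alg K fun _ => hΦ K, expectNext_history]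
    gcongr

/-- If adding an episode does not increase `Φ` in mean, then the mean of `Φ` stays below its initial
value. -/
lemma expectHistory_le_of_supermartingale (M : MDP H S A) (alg : Algorithm H S A)
    (Φ : (k : ℕ) → History H S A k → ℝ≥0∞) (hΦ : ∀ k, Measurable (Φ k)) {c : ℝ≥0∞}
    (h0 : ∀ D, Φ 0 D ≤ c)
    (hstep : ∀ k D π, ∫⁻ e, Φ (k + 1) (Fin.snoc (α := fun _ => Episode H S A) D e)
      ∂(episodeLaw M π) ≤ Φ k D) (K : ℕ) :
    expectHistory M alg K (Φ K) ≤ c := by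
  induction K with
  | zero =>
    unfold expectHistory
    calc _ ≤ ∫⁻ _, c ∂(runLaw M alg 0) := lintegral_mono fun _ => h0 _
      _ = c := by simp
  | succ K ih =>
    rw [expectHistory_succ M alg K (hΦ (K + 1))]
    refine (expectNext_mono M alg K (hstep K)).trans ?_
    rw [expectNext_history]
    exact ih

end Laws

/-! ### Concentration of the empirical model -/

section Concentration

open scoped ENNReal

/-- Hoeffding's lemma, as a bound on the exponential moment of `l (g - E g) - l² / 8`. -/
lemma lintegral_exp_hoeffding {Ω : Type*} [MeasurableSpace Ω] {μ : Measure Ω}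
    [IsProbabilityMeasure μ] {g : Ω → ℝ} (hg : Measurable g) {a b : ℝ} (hab : b - a = 1)
    (hb : ∀ᵐ z ∂μ, g z ∈ Set.Icc a b) (l : ℝ) :
    ∫⁻ z, ENNReal.ofReal (Real.exp (l * (g z - ∫ y, g y ∂μ) - l ^ 2 / 8)) ∂μ ≤ 1 := by
  have h := hasSubgaussianMGF_of_mem_Icc hg.aemeasurable hb
  have hm := h.mgf_le l
  have hi : Integrable (fun z => Real.exp (l * (g z - ∫ y, g y ∂μ))) μ := h.integrable_exp_mul l
  have e : ∀ z, Real.exp (l * (g z - ∫ y, g y ∂μ) - l ^ 2 / 8)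
      = Real.exp (l * (g z - ∫ y, g y ∂μ)) * Real.exp (-(l ^ 2 / 8)) := fun z => by
    rw [← Real.exp_add]; ring_nf
  simp only [e]
  rw [← ofReal_integral_eq_lintegral_ofReal (hi.mul_const _)
    (Filter.Eventually.of_forall fun z => by positivity), integral_mul_const]
  refine ENNReal.ofReal_le_one.2 ?_
  have hc : (((‖b - a‖₊ / 2) ^ 2 : NNReal) : ℝ) = 1 / 4 := by
    rw [hab]; norm_num
  rw [hc] at hm
  calc _ ≤ Real.exp (1 / 4 * l ^ 2 / 2) * Real.exp (-(l ^ 2 / 8)) := by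
        gcongr
        exact hm
    _ = 1 := by rw [← Real.exp_add]; ring_nf; exact Real.exp_zero

/-- The multiplicative Chernoff bound for an indicator, as a bound on an exponential moment. -/
lemma lintegral_exp_chernoff {Ω : Type*} [MeasurableSpace Ω] {μ : Measure Ω}
    [IsProbabilityMeasure μ] {g : Ω → ℝ} (hg : Measurable g) (h01 : ∀ z, g z = 0 ∨ g z = 1)
    {l : ℝ} (hl0 : 0 ≤ l) (hl1 : l ≤ 1) :
    ∫⁻ z, ENNReal.ofReal (Real.exp (l * g z - (l + l ^ 2) * ∫ y, g y ∂μ)) ∂μ ≤ 1 := by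
  have hgb : ∀ z, g z ∈ Set.Icc (0 : ℝ) 1 := fun z => by
    rcases h01 z with h | h <;> rw [h] <;> norm_num
  have hgi : Integrable g μ :=
    Integrable.of_mem_Icc 0 1 hg.aemeasurable (Filter.Eventually.of_forall hgb)
  have hexp : Real.exp l ≤ 1 + (l + l ^ 2) := by
    have := Real.abs_exp_sub_one_sub_id_le (x := l) (by rw [abs_of_nonneg hl0]; exact hl1)
    linarith [le_abs_self (Real.exp l - 1 - l)]
  set c := Real.exp (-((l + l ^ 2) * ∫ y, g y ∂μ)) with hc
  have hpt : ∀ z, Real.exp (l * g z - (l + l ^ 2) * ∫ y, g y ∂μ)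
      ≤ (1 + (l + l ^ 2) * g z) * c := fun z => by
    rw [sub_eq_add_neg, Real.exp_add, ← hc]
    refine mul_le_mul_of_nonneg_right ?_ (Real.exp_pos _).le
    rcases h01 z with h | h <;> rw [h]
    · simp
    · simpa using hexp
  calc _ ≤ ∫⁻ z, ENNReal.ofReal ((1 + (l + l ^ 2) * g z) * c) ∂μ :=
        lintegral_mono fun z => ENNReal.ofReal_le_ofReal (hpt z)
    _ = ENNReal.ofReal (∫ z, (1 + (l + l ^ 2) * g z) * c ∂μ) := by
        rw [ofReal_integral_eq_lintegral_ofReal]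
        · exact ((integrable_const _).add (hgi.const_mul _)).mul_const _
        · refine Filter.Eventually.of_forall fun z => ?_
          have := (hgb z).1
          simp only [Pi.zero_apply]
          positivity
    _ ≤ 1 := by
        refine ENNReal.ofReal_le_one.2 ?_
        rw [integral_mul_const, integral_add (integrable_const _) (hgi.const_mul _),
          integral_const_mul]
        simp only [integral_const, probReal_univ, smul_eq_mul, mul_one]
        calc _ ≤ Real.exp ((l + l ^ 2) * ∫ y, g y ∂μ) * c := by
              refine mul_le_mul_of_nonneg_right ?_ (Real.exp_pos _).le
              linarith [Real.add_one_le_exp ((l + l ^ 2) * ∫ y, g y ∂μ)]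
          _ = 1 := by rw [hc, ← Real.exp_add]; simp

variable {H S A : ℕ}

/-- The sum of `f` over the rewards and next states observed after playing `a` in `s` at
period `h`. -/
def obsSum {k : ℕ} (f : ℝ × Fin S → ℝ) (D : History H S A k) (h : Fin H) (s : Fin S) (a : Fin A) :
    ℝ :=
  ∑ i : Fin k, if (D i h).1 = s ∧ (D i h).2.1 = a then f ((D i h).2.2, nextState (D i) h) else 0

lemma measurableSet_record {k : ℕ} (i : Fin k) (h : Fin H) (s : Fin S) (a : Fin A) :
    MeasurableSet {D : History H S A k | (D i h).1 = s ∧ (D i h).2.1 = a} :=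
  (measurableSet_eq_fun (by fun_prop) (by fun_prop)).inter
    (measurableSet_eq_fun (by fun_prop) (by fun_prop))

lemma measurable_obsSum {k : ℕ} {f : ℝ × Fin S → ℝ} (hf : Measurable f) (h : Fin H) (s : Fin S)
    (a : Fin A) : Measurable fun D : History H S A k => obsSum f D h s a := by
  unfold obsSum
  refine Finset.measurable_fun_sum _ fun i _ => Measurable.ite (measurableSet_record i h s a) ?_
    measurable_const
  exact hf.comp (by fun_prop)

lemma visits_snoc {k : ℕ} (D : History H S A k) (e : Episode H S A) (h : Fin H) (s : Fin S)
    (a : Fin A) :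
    visits (Fin.snoc (α := fun _ => Episode H S A) D e : History H S A (k + 1)) h s a
      = visits D h s a + if (e h).1 = s ∧ (e h).2.1 = a then 1 else 0 := by
  unfold visits
  rw [Fin.sum_univ_castSucc]
  simp only [Fin.snoc_castSucc, Fin.snoc_last]

lemma obsSum_snoc {k : ℕ} (f : ℝ × Fin S → ℝ) (D : History H S A k) (e : Episode H S A) (h : Fin H)
    (s : Fin S) (a : Fin A) :
    obsSum f (Fin.snoc (α := fun _ => Episode H S A) D e : History H S A (k + 1)) h s a
      = obsSum f D h s a
        + if (e h).1 = s ∧ (e h).2.1 = a then f ((e h).2.2, nextState e h) else 0 := by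
  simp [obsSum, Fin.sum_univ_castSucc]

lemma visits_le {k : ℕ} (D : History H S A k) (h : Fin H) (s : Fin S) (a : Fin A) :
    visits D h s a ≤ k := by
  unfold visits
  calc _ ≤ ∑ _i : Fin k, 1 := Finset.sum_le_sum fun i _ => by split_ifs <;> omega
    _ = k := by simp

lemma obsSum_affine {k : ℕ} (c d : ℝ) (g : ℝ × Fin S → ℝ) (D : History H S A k) (h : Fin H)
    (s : Fin S) (a : Fin A) :
    obsSum (fun z => c * g z - d) D h s a = c * obsSum g D h s a - d * visits D h s a := by
  simp only [obsSum, visits, Finset.mul_sum, Nat.cast_sum, ← Finset.sum_sub_distrib]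
  refine Finset.sum_congr rfl fun i _ => ?_
  split_ifs <;> simp

/-- If `exp f` has mean at most one under `M.outcome h s a`, then the exponential of `obsSum f` is a
supermartingale over the episodes, whatever the algorithm does. -/
lemma expectHistory_exp_obsSum_le (M : MDP H S A) (alg : Algorithm H S A) (h : Fin H) (s : Fin S)
    (a : Fin A) {f : ℝ × Fin S → ℝ} (hf : Measurable f)
    (hf1 : ∫⁻ z, ENNReal.ofReal (Real.exp (f z)) ∂(M.outcome h s a) ≤ 1)
    (hlast : (h : ℕ) + 1 < H ∨ ∀ r t t', f (r, t) = f (r, t')) (k : ℕ) :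
    expectHistory M alg k (fun D => ENNReal.ofReal (Real.exp (obsSum f D h s a))) ≤ 1 := by
  refine expectHistory_le_of_supermartingale M alg
    (fun k D => ENNReal.ofReal (Real.exp (obsSum f D h s a)))
    (fun k => (measurable_obsSum hf h s a).exp.ennreal_ofReal) (fun D => by simp [obsSum])
    (fun k D π => ?_) k
  let F : Fin S × Fin A × ℝ × Fin S → ℝ≥0∞ := fun x =>
    if x.1 = s ∧ x.2.1 = a then ENNReal.ofReal (Real.exp (f x.2.2)) else 1
  have hF : Measurable F := by
    refine Measurable.ite ?_ (hf.comp (by fun_prop)).exp.ennreal_ofReal measurable_const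
    exact (measurableSet_eq_fun (by fun_prop) (by fun_prop)).inter
      (measurableSet_eq_fun (by fun_prop) (by fun_prop))
  have e : ∀ ep : Episode H S A, ENNReal.ofReal (Real.exp (obsSum f
      (Fin.snoc (α := fun _ => Episode H S A) D ep : History H S A (k + 1)) h s a))
      = ENNReal.ofReal (Real.exp (obsSum f D h s a))
        * F ((ep h).1, (ep h).2.1, (ep h).2.2, nextState ep h) := fun ep => by
    rw [obsSum_snoc, Real.exp_add, ENNReal.ofReal_mul (Real.exp_pos _).le]
    congr 1
    simp only [F]
    split_ifs <;> simp
  simp only [e]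
  rw [lintegral_const_mul _ (by fun_prop), lintegral_transition M π h hF]
  · have := isProbabilityMeasure_prefixLaw M π h h.isLt.le
    calc _ ≤ ENNReal.ofReal (Real.exp (obsSum f D h s a))
          * ∫⁻ _, 1 ∂(prefixLaw M π h h.isLt.le) := by
          gcongr with y
          by_cases hc : y.2 = s ∧ π h y.2 = a
          · obtain ⟨hc1, hc2⟩ := hc
            rw [hc1] at hc2
            simpa [F, hc1, hc2] using hf1
          · simp [F, hc]
      _ = _ := by simp
  · refine hlast.imp_right fun hc s' a' r t t' => ?_
    simp only [F, hc r t t']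

/-- The indicator that the next state is `t`, set to zero in the last period. -/
def nextIndicator (h : Fin H) (t : Fin S) (z : ℝ × Fin S) : ℝ :=
  if (h : ℕ) + 1 < H ∧ z.2 = t then 1 else 0

lemma measurable_nextIndicator (h : Fin H) (t : Fin S) :
    Measurable (nextIndicator (S := S) h t) :=
  (measurable_of_finite fun s : Fin S => if (h : ℕ) + 1 < H ∧ s = t then (1 : ℝ) else 0).comp
    measurable_snd

lemma integral_nextIndicator (M : MDP H S A) (h : Fin H) (s : Fin S) (a : Fin A) (t : Fin S) :
    ∫ z, nextIndicator h t z ∂(M.outcome h s a)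
      = if (h : ℕ) + 1 < H then M.tabular.P h s a t else 0 := by
  have hm : MeasurableSet {x : ℝ × Fin S | x.2 = t} :=
    measurableSet_eq_fun measurable_snd measurable_const
  by_cases hh : (h : ℕ) + 1 < H
  · have : (nextIndicator h t : ℝ × Fin S → ℝ) = Set.indicator {x | x.2 = t} fun _ => 1 := by
      funext z
      simp [nextIndicator, hh, Set.indicator_apply]
    rw [this, integral_indicator_const _ hm]
    simp [hh, MDP.tabular]
  · simp [nextIndicator, hh]

lemma empReward_eq_obsSum {k : ℕ} (D : History H S A k) (h : Fin H) (s : Fin S) (a : Fin A) :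
    empReward D h s a = (visits D h s a : ℝ)⁻¹ * obsSum Prod.fst D h s a := rfl

lemma empTrans_eq_obsSum {k : ℕ} (D : History H S A k) (h : Fin H) (s : Fin S) (a : Fin A)
    (t : Fin S) :
    empTrans D h s a t = (visits D h s a : ℝ)⁻¹ * obsSum (nextIndicator h t) D h s a := by
  unfold empTrans obsSum
  by_cases hh : (h : ℕ) + 1 < H
  · simp only [hh, dif_pos, nextIndicator, nextState, true_and]
    congr 1
    refine Finset.sum_congr rfl fun i _ => ?_
    split_ifs <;> simp_all
  · simp [hh, nextIndicator]

lemma empTrans_nonneg {k : ℕ} (D : History H S A k) (h : Fin H) (s : Fin S) (a : Fin A)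
    (t : Fin S) : 0 ≤ empTrans D h s a t := by
  unfold empTrans
  split_ifs
  · exact mul_nonneg (by positivity) (Finset.sum_nonneg fun i _ => by split_ifs <;> norm_num)
  · exact le_rfl

lemma sum_empTrans_le_one {k : ℕ} (D : History H S A k) (h : Fin H) (s : Fin S) (a : Fin A) :
    ∑ t, empTrans D h s a t ≤ 1 := by
  simp only [empTrans_eq_obsSum, ← Finset.mul_sum]
  have : ∑ t, obsSum (nextIndicator h t) D h s a ≤ visits D h s a := by
    unfold obsSum visits
    rw [Finset.sum_comm]
    push_cast
    refine Finset.sum_le_sum fun i _ => ?_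
    split_ifs
    · simp only [nextIndicator]
      by_cases hh : (h : ℕ) + 1 < H <;> simp [hh]
    · simp
  calc _ ≤ (visits D h s a : ℝ)⁻¹ * visits D h s a := by gcongr
    _ ≤ 1 := inv_mul_le_one

/-- On this event the empirical model is close to the true one, up to deviations governed by `x`.
The function `V` is the value function of a comparator; for it the one-sided deviation carries the
factor `H` only, with no union bound over next states. -/
structure IsGood (M : MDP H S A) (V : ℕ → Fin S → ℝ) (x : ℝ) {k : ℕ} (D : History H S A k) :
    Prop where
  backup : ∀ h s a, M.tabular.R h s a + ∑ t, M.tabular.P h s a t * V (h + 1) t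
      - H * √(x / (visits D h s a + 1))
    ≤ empReward D h s a + ∑ t, empTrans D h s a t * V (h + 1) t
  reward : ∀ h s a, empReward D h s a ≤ M.tabular.R h s a + √(x / (visits D h s a + 1))
  trans : ∀ h s a t, empTrans D h s a t
    ≤ M.tabular.P h s a t + √(x / (visits D h s a + 1))
  trans_mul : ∀ h s a t, empTrans D h s a t
    ≤ (1 + 1 / H) * M.tabular.P h s a t + 2 * H * x / (visits D h s a + 1)

/-- The test function whose exponential controls the mean deviation of `g` after `n` visits. -/
def hoeffdingTest (μ : Measure (ℝ × Fin S)) (x : ℝ) (n : ℕ) (g : ℝ × Fin S → ℝ) (z : ℝ × Fin S) :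
    ℝ :=
  √(8 * x / n) * g z - (√(8 * x / n) * (∫ y, g y ∂μ) + √(8 * x / n) ^ 2 / 8)

/-- The test function for multiplicative deviations of an indicator `g`, with parameter `1 / H`. -/
def chernoffTest (μ : Measure (ℝ × Fin S)) (H : ℕ) (g : ℝ × Fin S → ℝ) (z : ℝ × Fin S) : ℝ :=
  (1 / H : ℝ) * g z - (1 / H + (1 / H) ^ 2 : ℝ) * ∫ y, g y ∂μ

/-- The observables to which Hoeffding's inequality is applied: the negative of the normalized
Bellman backup of `V`, the reward, and the indicators of the next states. -/
def observable (V : ℕ → Fin S → ℝ) (h : Fin H) : Option (Option (Fin S)) → ℝ × Fin S → ℝ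
  | none, z => -((z.1 + V (h + 1) z.2) / H)
  | some none, z => z.1
  | some (some t), z => nextIndicator h t z

lemma measurable_observable (V : ℕ → Fin S → ℝ) (h : Fin H) (j : Option (Option (Fin S))) :
    Measurable (observable V h j) := by
  rcases j with _ | _ | t
  · have : Measurable fun z : ℝ × Fin S => V (h + 1) z.2 :=
      (measurable_of_finite (V (h + 1))).comp measurable_snd
    unfold observable
    fun_prop
  · exact measurable_fst
  · exact measurable_nextIndicator h t

/-- The test functions used after `k` episodes: Hoeffding tests for every possible number of visits
in `1, …, k`, and Chernoff tests for the next states. -/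
def testFunction (M : MDP H S A) (V : ℕ → Fin S → ℝ) (x : ℝ) (k : ℕ) (h : Fin H) (s : Fin S)
    (a : Fin A) : (Fin k × Option (Option (Fin S))) ⊕ Fin S → ℝ × Fin S → ℝ
  | Sum.inl (n, j) => hoeffdingTest (M.outcome h s a) x (n + 1) (observable V h j)
  | Sum.inr t => chernoffTest (M.outcome h s a) H (nextIndicator h t)

/-- The sum of the exponential supermartingales of all test functions. -/
def totalTest (M : MDP H S A) (V : ℕ → Fin S → ℝ) (x : ℝ) (k : ℕ) (D : History H S A k) : ℝ≥0∞ :=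
  ∑ i : (Fin H × Fin S × Fin A) × ((Fin k × Option (Option (Fin S))) ⊕ Fin S),
    ENNReal.ofReal (Real.exp (obsSum (testFunction M V x k i.1.1 i.1.2.1 i.1.2.2 i.2) D
      i.1.1 i.1.2.1 i.1.2.2))

lemma measurable_testFunction (M : MDP H S A) (V : ℕ → Fin S → ℝ) (x : ℝ) (k : ℕ) (h : Fin H)
    (s : Fin S) (a : Fin A) (j) : Measurable (testFunction M V x k h s a j) := by
  rcases j with ⟨n, j⟩ | t
  · have := measurable_observable V h j
    unfold testFunction hoeffdingTest
    fun_prop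
  · have := measurable_nextIndicator h t
    unfold testFunction chernoffTest
    fun_prop

lemma measurable_totalTest (M : MDP H S A) (V : ℕ → Fin S → ℝ) (x : ℝ) (k : ℕ) :
    Measurable (totalTest M V x k) :=
  Finset.measurable_sum _ fun _ _ =>
    (measurable_obsSum (measurable_testFunction M V x k _ _ _ _) _ _ _).exp.ennreal_ofReal

/-- The values of a comparator lie between `0` and the number of remaining periods. -/
def IsValueBounded (H : ℕ) (V : ℕ → Fin S → ℝ) : Prop :=
  ∀ h s, 0 ≤ V h s ∧ V h s ≤ ((H - h : ℕ) : ℝ)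

lemma IsValueBounded.last {V : ℕ → Fin S → ℝ} (hV : IsValueBounded H V) {h : ℕ} (hh : H ≤ h)
    (s : Fin S) : V h s = 0 := by
  have := hV h s
  rw [Nat.sub_eq_zero_of_le hh] at this
  exact le_antisymm (by simpa using this.2) this.1

lemma IsValueBounded.succ_le {V : ℕ → Fin S → ℝ} (hV : IsValueBounded H V) (h : Fin H)
    (s : Fin S) : V (h + 1) s ≤ (H : ℝ) - 1 := by
  have h1 := (hV (h + 1) s).2
  have h2 : (((H - (h + 1) : ℕ) : ℝ)) ≤ (H : ℝ) - 1 := by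
    have := h.isLt
    have h3 : H - ((h : ℕ) + 1) + 1 ≤ H := by omega
    have h4 : (((H - ((h : ℕ) + 1) + 1 : ℕ)) : ℝ) ≤ H := by exact_mod_cast h3
    push_cast at h4 ⊢
    linarith
  exact h1.trans h2

lemma observable_mem (M : MDP H S A) {V : ℕ → Fin S → ℝ} (hV : IsValueBounded H V) (h : Fin H)
    (s : Fin S) (a : Fin A) (j : Option (Option (Fin S))) :
    ∃ u v : ℝ, v - u = 1 ∧ ∀ᵐ z ∂(M.outcome h s a), observable V h j z ∈ Set.Icc u v := by
  have hH : (0 : ℝ) < H := by exact_mod_cast h.pos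
  rcases j with _ | _ | t
  · refine ⟨-1, 0, by norm_num, ?_⟩
    filter_upwards [M.reward_mem h s a] with z hz
    have h1 := (hV (h + 1) z.2).1
    have h2 := hV.succ_le h z.2
    have h3 := hz.1
    have h4 := hz.2
    have h5 : (z.1 + V (h + 1) z.2) / H ≤ 1 := by rw [div_le_one hH]; linarith
    have h6 : 0 ≤ (z.1 + V (h + 1) z.2) / H := by positivity
    simp only [observable]
    constructor <;> linarith
  · exact ⟨0, 1, by norm_num, M.reward_mem h s a⟩
  · refine ⟨0, 1, by norm_num, Filter.Eventually.of_forall fun z => ?_⟩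
    simp only [observable, nextIndicator]
    split_ifs <;> norm_num

lemma expectHistory_totalTest_le (M : MDP H S A) (alg : Algorithm H S A) {V : ℕ → Fin S → ℝ}
    (hV : IsValueBounded H V) (x : ℝ) (k : ℕ) :
    expectHistory M alg k (totalTest M V x k)
      ≤ ((H * S * A * (k * (S + 2) + S) : ℕ) : ℝ≥0∞) := by
  have key : ∀ i : (Fin H × Fin S × Fin A) × ((Fin k × Option (Option (Fin S))) ⊕ Fin S),
      expectHistory M alg k (fun D => ENNReal.ofReal (Real.exp (obsSum
        (testFunction M V x k i.1.1 i.1.2.1 i.1.2.2 i.2) D i.1.1 i.1.2.1 i.1.2.2))) ≤ 1 := by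
    rintro ⟨⟨h, s, a⟩, j⟩
    refine expectHistory_exp_obsSum_le M alg h s a (measurable_testFunction M V x k h s a j) ?_ ?_ k
    · rcases j with ⟨n, j⟩ | t
      · obtain ⟨u, v, huv, hm⟩ := observable_mem M hV h s a j
        refine le_of_eq_of_le ?_ (lintegral_exp_hoeffding (measurable_observable V h j) huv hm
          (√(8 * x / ((n + 1 : ℕ) : ℝ))))
        refine lintegral_congr fun z => ?_
        simp only [testFunction, hoeffdingTest]
        congr 2
        ring
      · have hH : (1 : ℝ) ≤ H := by exact_mod_cast h.pos
        refine lintegral_exp_chernoff (measurable_nextIndicator h t) (fun z => ?_) (by positivity)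
          ((div_le_one (by linarith)).2 hH)
        simp only [nextIndicator]
        split_ifs <;> simp
    · by_cases hh : (h : ℕ) + 1 < H
      · exact Or.inl hh
      · refine Or.inr fun r t t' => ?_
        rcases j with ⟨n, _ | _ | u⟩ | u
        · simp [testFunction, hoeffdingTest, observable, hV.last (not_lt.1 hh)]
        · simp [testFunction, hoeffdingTest, observable]
        · simp [testFunction, hoeffdingTest, observable, nextIndicator, hh]
        · simp [testFunction, chernoffTest, nextIndicator, hh]
  calc expectHistory M alg k (totalTest M V x k)
      = ∑ i : (Fin H × Fin S × Fin A) × ((Fin k × Option (Option (Fin S))) ⊕ Fin S),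
          expectHistory M alg k (fun D => ENNReal.ofReal (Real.exp (obsSum
            (testFunction M V x k i.1.1 i.1.2.1 i.1.2.2 i.2) D i.1.1 i.1.2.1 i.1.2.2))) := by
        unfold expectHistory totalTest
        refine lintegral_finsetSum _ fun i _ => ?_
        have hm := (measurable_obsSum (k := k) (measurable_testFunction M V x k i.1.1
          i.1.2.1 i.1.2.2 i.2) i.1.1 i.1.2.1 i.1.2.2).exp.ennreal_ofReal
        exact hm.comp (measurable_history alg)
    _ ≤ ∑ _i : (Fin H × Fin S × Fin A) × ((Fin k × Option (Option (Fin S))) ⊕ Fin S), 1 :=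
        Finset.sum_le_sum fun i _ => key i
    _ = _ := by
        simp only [Finset.sum_const, Finset.card_univ, Fintype.card_prod, Fintype.card_sum,
          Fintype.card_fin, Fintype.card_option, nsmul_eq_mul, mul_one]
        congr 1
        ring

/-- If the Hoeffding test after exactly `n = visits` samples does not exceed `x`, the sample
mean exceeds the mean by at most `√(x / (n + 1))`. -/
lemma obsSum_mean_le_of_hoeffdingTest {k : ℕ} (D : History H S A k) (h : Fin H) (s : Fin S)
    (a : Fin A) (μ : Measure (ℝ × Fin S)) {x : ℝ} (hx : 0 < x) (g : ℝ × Fin S → ℝ)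
    (hn : 0 < visits D h s a)
    (ht : obsSum (hoeffdingTest μ x (visits D h s a) g) D h s a ≤ x) :
    (visits D h s a : ℝ)⁻¹ * obsSum g D h s a
      ≤ (∫ y, g y ∂μ) + √(x / (visits D h s a + 1)) := by
  set n := visits D h s a with hndef
  have hn1 : (1 : ℝ) ≤ n := by exact_mod_cast hn
  unfold hoeffdingTest at ht
  rw [obsSum_affine, ← hndef] at ht
  set l := √(8 * x / n) with hl
  have hl2 : l ^ 2 = 8 * x / n := Real.sq_sqrt (by positivity)
  have hlpos : 0 < l := Real.sqrt_pos.2 (by positivity)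
  have hnl : n * l ^ 2 = 8 * x := by rw [hl2]; field_simp
  -- the parameter `l` balances `x / l` against `n l / 8`, both equal to `n l / 8`
  have h1 : obsSum g D h s a ≤ n * (∫ y, g y ∂μ) + n * (l / 4) := by
    have h2 : l * (obsSum g D h s a) ≤ l * (n * (∫ y, g y ∂μ) + n * (l / 4)) := by nlinarith
    exact le_of_mul_le_mul_left h2 hlpos
  have h3 : l / 4 ≤ √(x / (n + 1)) := by
    refine Real.le_sqrt_of_sq_le ?_
    rw [div_pow, hl2, div_div, div_le_div_iff₀ (by positivity) (by positivity)]
    nlinarith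
  calc (n : ℝ)⁻¹ * obsSum g D h s a ≤ (n : ℝ)⁻¹ * (n * (∫ y, g y ∂μ) + n * (l / 4)) := by gcongr
    _ = (∫ y, g y ∂μ) + l / 4 := by field_simp
    _ ≤ _ := by gcongr

lemma obsSum_mean_le_of_chernoffTest {k : ℕ} (D : History H S A k) (h : Fin H) (s : Fin S)
    (a : Fin A) (μ : Measure (ℝ × Fin S)) {x : ℝ} (hx : 0 < x) (g : ℝ × Fin S → ℝ)
    (hn : 0 < visits D h s a) (ht : obsSum (chernoffTest μ H g) D h s a ≤ x) :
    (visits D h s a : ℝ)⁻¹ * obsSum g D h s a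
      ≤ (1 + 1 / H) * (∫ y, g y ∂μ) + 2 * H * x / (visits D h s a + 1) := by
  set n := visits D h s a with hndef
  have hn1 : (1 : ℝ) ≤ n := by exact_mod_cast hn
  have hH : (0 : ℝ) < H := by exact_mod_cast h.pos
  unfold chernoffTest at ht
  rw [obsSum_affine, ← hndef] at ht
  have h1 : obsSum g D h s a ≤ n * ((1 + 1 / H) * (∫ y, g y ∂μ)) + H * x := by
    have h2 : obsSum g D h s a = H * (1 / H * obsSum g D h s a) := by field_simp
    have h3 : (n : ℝ) * ((1 + 1 / H) * (∫ y, g y ∂μ))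
        = H * ((1 / H + (1 / H) ^ 2) * (∫ y, g y ∂μ) * n) := by field_simp
    rw [h2, h3, ← mul_add]
    gcongr
    linarith
  have h4 : (n : ℝ)⁻¹ * (H * x) ≤ 2 * H * x / (n + 1) := by
    rw [inv_mul_eq_div, div_le_div_iff₀ (by positivity) (by positivity)]
    have : 0 < H * x := by positivity
    nlinarith
  calc (n : ℝ)⁻¹ * obsSum g D h s a
      ≤ (n : ℝ)⁻¹ * (n * ((1 + 1 / H) * (∫ y, g y ∂μ)) + H * x) := by gcongr
    _ = (1 + 1 / H) * (∫ y, g y ∂μ) + (n : ℝ)⁻¹ * (H * x) := by field_simp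
    _ ≤ _ := by gcongr

lemma obsSum_add {k : ℕ} (f g : ℝ × Fin S → ℝ) (D : History H S A k) (h : Fin H) (s : Fin S)
    (a : Fin A) : obsSum (fun z => f z + g z) D h s a = obsSum f D h s a + obsSum g D h s a := by
  simp only [obsSum, ← Finset.sum_add_distrib]
  exact Finset.sum_congr rfl fun i _ => by split_ifs <;> simp

/-- The empirical Bellman backup of `V` is a sample mean. -/
lemma empBackup_eq_obsSum {k : ℕ} (D : History H S A k) {V : ℕ → Fin S → ℝ}
    (hV : IsValueBounded H V) (h : Fin H) (s : Fin S) (a : Fin A) :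
    empReward D h s a + ∑ t, empTrans D h s a t * V (h + 1) t
      = (visits D h s a : ℝ)⁻¹ * obsSum (fun z => z.1 + V (h + 1) z.2) D h s a := by
  rw [obsSum_add, mul_add, empReward_eq_obsSum]
  congr 1
  simp only [empTrans_eq_obsSum, mul_assoc, ← Finset.mul_sum]
  congr 1
  unfold obsSum
  simp only [Finset.sum_mul]
  rw [Finset.sum_comm]
  refine Finset.sum_congr rfl fun i _ => ?_
  split_ifs
  · by_cases hh : (h : ℕ) + 1 < H
    · simp [nextIndicator, hh]
    · simp [nextIndicator, hh, hV.last (not_lt.1 hh)]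
  · simp

lemma integral_backup (M : MDP H S A) (V : ℕ → Fin S → ℝ) (h : Fin H) (s : Fin S) (a : Fin A) :
    ∫ z, (z.1 + V (h + 1) z.2) ∂(M.outcome h s a)
      = M.tabular.R h s a + ∑ t, M.tabular.P h s a t * V (h + 1) t := by
  have hi : Integrable (fun z : ℝ × Fin S => z.1) (M.outcome h s a) :=
    Integrable.of_mem_Icc 0 1 measurable_fst.aemeasurable (M.reward_mem h s a)
  have hm : ∀ t : Fin S, MeasurableSet {x : ℝ × Fin S | x.2 = t} := fun t =>
    measurableSet_eq_fun measurable_snd measurable_const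
  have e : ∀ z : ℝ × Fin S, V (h + 1) z.2
      = ∑ t, Set.indicator {x : ℝ × Fin S | x.2 = t} (fun _ => V (h + 1) t) z := fun z => by
    simp [Set.indicator_apply]
  have hi2 : ∀ t : Fin S, Integrable (Set.indicator {x : ℝ × Fin S | x.2 = t}
      (fun _ => V (h + 1) t)) (M.outcome h s a) := fun t => (integrable_const _).indicator (hm t)
  simp only [e]
  rw [integral_add hi (integrable_finsetSum _ fun t _ => hi2 t),
    integral_finsetSum _ fun t _ => hi2 t]
  congr 1
  refine Finset.sum_congr rfl fun t _ => ?_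
  rw [integral_indicator_const _ (hm t), smul_eq_mul]
  rfl

lemma MDP.tabular_P_nonneg (M : MDP H S A) (h : Fin H) (s : Fin S) (a : Fin A) (t : Fin S) :
    0 ≤ M.tabular.P h s a t := measureReal_nonneg

lemma MDP.sum_tabular_P (M : MDP H S A) (h : Fin H) (s : Fin S) (a : Fin A) :
    ∑ t, M.tabular.P h s a t = 1 := by
  have hm : Measurable fun z : ℝ × Fin S => z.2 := measurable_snd
  have : IsProbabilityMeasure ((M.outcome h s a).map fun z => z.2) :=
    Measure.isProbabilityMeasure_map hm.aemeasurable
  have e : ∀ t, M.tabular.P h s a t = ((M.outcome h s a).map fun z => z.2).real {t} := fun t => by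
    rw [map_measureReal_apply hm (measurableSet_singleton t)]
    rfl
  simp only [e]
  rw [sum_measureReal_singleton]
  simp

lemma MDP.tabular_R_mem (M : MDP H S A) (h : Fin H) (s : Fin S) (a : Fin A) :
    0 ≤ M.tabular.R h s a ∧ M.tabular.R h s a ≤ 1 := by
  have hi : Integrable (fun z : ℝ × Fin S => z.1) (M.outcome h s a) :=
    Integrable.of_mem_Icc 0 1 measurable_fst.aemeasurable (M.reward_mem h s a)
  constructor
  · refine integral_nonneg_of_ae ?_
    filter_upwards [M.reward_mem h s a] with z hz using hz.1
  · calc M.tabular.R h s a ≤ ∫ _, (1 : ℝ) ∂(M.outcome h s a) := by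
          refine integral_mono_ae hi (integrable_const _) ?_
          filter_upwards [M.reward_mem h s a] with z hz using hz.2
      _ = 1 := by simp

lemma isGood_of_totalTest_le (M : MDP H S A) {V : ℕ → Fin S → ℝ} (hV : IsValueBounded H V) {x : ℝ}
    (hx : 1 ≤ x) {k : ℕ} (D : History H S A k)
    (hD : totalTest M V x k D ≤ ENNReal.ofReal (Real.exp x)) : IsGood M V x D := by
  have hx0 : 0 < x := by linarith
  have hterm : ∀ h s a j, obsSum (testFunction M V x k h s a j) D h s a ≤ x := by
    intro h s a j
    have h1 : ENNReal.ofReal (Real.exp (obsSum (testFunction M V x k h s a j) D h s a))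
        ≤ totalTest M V x k D :=
      Finset.single_le_sum (f := fun i : (Fin H × Fin S × Fin A) ×
        ((Fin k × Option (Option (Fin S))) ⊕ Fin S) => ENNReal.ofReal (Real.exp (obsSum
          (testFunction M V x k i.1.1 i.1.2.1 i.1.2.2 i.2) D i.1.1 i.1.2.1 i.1.2.2)))
        (fun _ _ => zero_le) (Finset.mem_univ (⟨⟨h, s, a⟩, j⟩ :
          (Fin H × Fin S × Fin A) × ((Fin k × Option (Option (Fin S))) ⊕ Fin S)))
    have h2 := h1.trans hD
    rwa [ENNReal.ofReal_le_ofReal_iff (Real.exp_pos _).le, Real.exp_le_exp] at h2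
  have hhoef : ∀ h s a, 0 < visits D h s a → ∀ j,
      (visits D h s a : ℝ)⁻¹ * obsSum (observable V h j) D h s a
        ≤ (∫ y, observable V h j y ∂(M.outcome h s a)) + √(x / (visits D h s a + 1)) := by
    intro h s a hn j
    refine obsSum_mean_le_of_hoeffdingTest D h s a _ hx0 _ hn ?_
    have hk := visits_le D h s a
    have := hterm h s a (Sum.inl (⟨visits D h s a - 1, by omega⟩, j))
    have e : visits D h s a - 1 + 1 = visits D h s a := by omega
    simpa only [testFunction, e] using this
  refine ⟨fun h s a => ?_, fun h s a => ?_, fun h s a t => ?_, fun h s a t => ?_⟩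
  · have hH : (0 : ℝ) < H := by exact_mod_cast h.pos
    rcases Nat.eq_zero_or_pos (visits D h s a) with hn | hn
    · have h1 : empReward D h s a + ∑ t, empTrans D h s a t * V (h + 1) t = 0 := by
        rw [empBackup_eq_obsSum D hV, hn]; simp
      have h2 : ∑ t, M.tabular.P h s a t * V (h + 1) t ≤ ∑ t, M.tabular.P h s a t * ((H : ℝ) - 1) :=
        Finset.sum_le_sum fun t _ =>
          mul_le_mul_of_nonneg_left (hV.succ_le h t) (M.tabular_P_nonneg h s a t)
      rw [← Finset.sum_mul, M.sum_tabular_P, one_mul] at h2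
      have h3 := (M.tabular_R_mem h s a).2
      have h4 : (1 : ℝ) ≤ √(x / ((visits D h s a : ℝ) + 1)) := by
        rw [hn]; exact Real.le_sqrt_of_sq_le (by simpa using hx)
      rw [h1]
      nlinarith
    · have h1 := hhoef h s a hn none
      have e1 : ∫ y, observable V h none y ∂(M.outcome h s a)
          = -((M.tabular.R h s a + ∑ t, M.tabular.P h s a t * V (h + 1) t) / H) := by
        rw [← integral_backup M V h s a, ← integral_div, ← integral_neg]
        rfl
      have e2 : obsSum (observable V h none) D h s a
          = -(obsSum (fun z => z.1 + V (h + 1) z.2) D h s a / H) := by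
        have := obsSum_affine (-(1 / (H : ℝ))) 0 (fun z => z.1 + V (h + 1) z.2) D h s a
        rw [zero_mul, sub_zero] at this
        rw [show -(obsSum (fun z => z.1 + V (h + 1) z.2) D h s a / H)
          = -(1 / (H : ℝ)) * obsSum (fun z => z.1 + V (h + 1) z.2) D h s a by ring, ← this]
        congr 1
        funext z
        simp only [observable]
        ring
      rw [e1, e2] at h1
      rw [empBackup_eq_obsSum D hV]
      have h2 := mul_le_mul_of_nonneg_left h1 hH.le
      have e3 : (H : ℝ) * ((visits D h s a : ℝ)⁻¹
          * -(obsSum (fun z => z.1 + V (h + 1) z.2) D h s a / H))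
          = -((visits D h s a : ℝ)⁻¹ * obsSum (fun z => z.1 + V (h + 1) z.2) D h s a) := by
        field_simp
      have e4 : (H : ℝ) * (-((M.tabular.R h s a + ∑ t, M.tabular.P h s a t * V (h + 1) t) / H)
          + √(x / (visits D h s a + 1)))
          = -(M.tabular.R h s a + ∑ t, M.tabular.P h s a t * V (h + 1) t)
            + H * √(x / (visits D h s a + 1)) := by
        field_simp
      rw [e3, e4] at h2
      linarith
  · rcases Nat.eq_zero_or_pos (visits D h s a) with hn | hn
    · rw [empReward_eq_obsSum, hn]
      have := (M.tabular_R_mem h s a).1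
      simp only [Nat.cast_zero, inv_zero, zero_mul]
      positivity
    · exact hhoef h s a hn (some none)
  · have hP := M.tabular_P_nonneg h s a t
    rcases Nat.eq_zero_or_pos (visits D h s a) with hn | hn
    · rw [empTrans_eq_obsSum, hn]
      simp only [Nat.cast_zero, inv_zero, zero_mul]
      positivity
    · rw [empTrans_eq_obsSum]
      refine (hhoef h s a hn (some (some t))).trans ?_
      change (∫ y, nextIndicator h t y ∂(M.outcome h s a)) + _ ≤ _
      rw [integral_nextIndicator]
      split_ifs <;> linarith
  · have hP := M.tabular_P_nonneg h s a t
    rcases Nat.eq_zero_or_pos (visits D h s a) with hn | hn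
    · rw [empTrans_eq_obsSum, hn]
      simp only [Nat.cast_zero, inv_zero, zero_mul]
      positivity
    · rw [empTrans_eq_obsSum]
      refine (obsSum_mean_le_of_chernoffTest D h s a (M.outcome h s a) hx0 _ hn
        (hterm h s a (Sum.inr t))).trans ?_
      rw [integral_nextIndicator]
      gcongr
      split_ifs <;> linarith

open scoped Classical in
/-- The empirical model is good outside an event of small probability. -/
lemma expectHistory_not_isGood_le (M : MDP H S A) (alg : Algorithm H S A) {V : ℕ → Fin S → ℝ}
    (hV : IsValueBounded H V) {x : ℝ} (hx : 1 ≤ x) (k : ℕ) :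
    expectHistory M alg k (fun D => if IsGood M V x D then 0 else 1)
      ≤ ENNReal.ofReal (Real.exp (-x) * (H * S * A * (k * (S + 2) + S))) := by
  calc _ ≤ expectHistory M alg k
        (fun D => ENNReal.ofReal (Real.exp (-x)) * totalTest M V x k D) := by
        refine lintegral_mono fun ω => ?_
        dsimp only
        split_ifs with hg
        · exact zero_le
        · have h1 : ENNReal.ofReal (Real.exp x) ≤ totalTest M V x k ω.history := by
            by_contra hc
            exact hg (isGood_of_totalTest_le M hV hx _ (not_le.1 hc).le)
          calc (1 : ℝ≥0∞) = ENNReal.ofReal (Real.exp (-x)) * ENNReal.ofReal (Real.exp x) := by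
                rw [← ENNReal.ofReal_mul (Real.exp_pos _).le, ← Real.exp_add]; simp
            _ ≤ _ := by gcongr
    _ = ENNReal.ofReal (Real.exp (-x)) * expectHistory M alg k (totalTest M V x k) := by
        exact lintegral_const_mul _ ((measurable_totalTest M V x k).comp (measurable_history alg))
    _ ≤ ENNReal.ofReal (Real.exp (-x)) * ((H * S * A * (k * (S + 2) + S) : ℕ) : ℝ≥0∞) := by
        gcongr
        exact expectHistory_totalTest_le M alg hV x k
    _ = _ := by
        rw [ENNReal.ofReal_mul (Real.exp_pos _).le, ← ENNReal.ofReal_natCast]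
        push_cast
        rfl

end Concentration

/-! ### Gaussian noise and optimism -/

section Gaussian

open scoped ENNReal

variable {ι : Type*} [Fintype ι]

/-- The law of independent standard Gaussian variables indexed by `ι`. -/
def stdNoise (ι : Type*) [Fintype ι] : Measure (ι → ℝ) := Measure.pi fun _ => gaussianReal 0 1

instance : IsProbabilityMeasure (stdNoise ι) := by
  unfold stdNoise
  infer_instance

lemma map_sum_stdNoise (c : ι → ℝ) :
    (stdNoise ι).map (fun ξ => ∑ i, c i * ξ i) = (gaussianReal 0 1).map (√(∑ i, c i ^ 2) * ·) := by
  have hind : iIndepFun (fun i (ξ : ι → ℝ) => c i * ξ i) (stdNoise ι) :=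
    iIndepFun_pi (X := fun i (x : ℝ) => c i * x) fun i => by fun_prop
  have hlaw : ∀ i, HasGaussianLaw (fun ξ : ι → ℝ => c i * ξ i) (stdNoise ι) := fun i => by
    have h1 : HasGaussianLaw (fun ξ : ι → ℝ => ξ i) (stdNoise ι) := by
      refine ⟨?_⟩
      have : (stdNoise ι).map (fun ξ => ξ i) = gaussianReal 0 1 :=
        (measurePreserving_eval (fun _ : ι => gaussianReal 0 1) i).map_eq
      rw [this]
      infer_instance
    exact h1.fun_smul (c i)
  have hsum := hind.hasGaussianLaw_fun_sum hlaw
  have hmean : ∫ ξ, ∑ i, c i * ξ i ∂(stdNoise ι) = 0 := by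
    rw [integral_finsetSum _ fun i _ => (hlaw i).integrable]
    refine Finset.sum_eq_zero fun i _ => ?_
    rw [integral_const_mul]
    have : ∫ ξ : ι → ℝ, ξ i ∂(stdNoise ι) = 0 := by
      unfold stdNoise
      rw [integral_eval]
      simp
    rw [this, mul_zero]
  have hvar : Var[fun ξ => ∑ i, c i * ξ i; stdNoise ι] = ∑ i, c i ^ 2 := by
    have e : (fun ξ : ι → ℝ => ∑ i, c i * ξ i) = ∑ i, fun ξ : ι → ℝ => c i * ξ i := by
      ext ξ; simp
    rw [e]
    unfold stdNoise
    rw [variance_sum_pi (X := fun i (x : ℝ) => c i * x)]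
    · refine Finset.sum_congr rfl fun i _ => ?_
      change Var[fun x => c i * id x; gaussianReal 0 1] = _
      rw [variance_const_mul, variance_id_gaussianReal]
      simp
    · exact fun i => IsGaussian.memLp_two_id.const_mul _
  rw [hsum.map_eq_gaussianReal, hmean, hvar, gaussianReal_map_const_mul, mul_zero, mul_one]
  congr 1
  ext
  have : 0 ≤ ∑ i, c i ^ 2 := Finset.sum_nonneg fun i _ => sq_nonneg _
  simp [Real.coe_toNNReal _ this, Real.sq_sqrt this]

/-- The probability that a standard Gaussian variable exceeds `3`. -/
def optimismProb : ℝ := (gaussianReal 0 1).real (Set.Ici 3)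

lemma optimismProb_pos : 0 < optimismProb := by
  have h : gaussianReal 0 1 (Set.Ici 3) ≠ 0 := fun h0 => by
    have := (gaussianReal_absolutelyContinuous' 0 (one_ne_zero (α := NNReal))) h0
    simp at this
  exact ENNReal.toReal_pos h (measure_ne_top _ _)

/-- A linear combination of independent Gaussian variables exceeds three standard deviations with
a probability that does not depend on the coefficients. -/
lemma optimismProb_le_sum (c : ι → ℝ) :
    optimismProb ≤ (stdNoise ι).real {ξ | 3 * √(∑ i, c i ^ 2) ≤ ∑ i, c i * ξ i} := by
  have hm : MeasurableSet {y : ℝ | 3 * √(∑ i, c i ^ 2) ≤ y} := measurableSet_Ici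
  have h1 : (stdNoise ι).real {ξ | 3 * √(∑ i, c i ^ 2) ≤ ∑ i, c i * ξ i}
      = ((stdNoise ι).map fun ξ => ∑ i, c i * ξ i).real {y | 3 * √(∑ i, c i ^ 2) ≤ y} := by
    rw [map_measureReal_apply (by fun_prop) hm]
    rfl
  rw [h1, map_sum_stdNoise, map_measureReal_apply (by fun_prop) hm]
  refine measureReal_mono fun y hy => ?_
  have hy3 : (3 : ℝ) ≤ y := hy
  change 3 * √(∑ i, c i ^ 2) ≤ √(∑ i, c i ^ 2) * y
  rw [mul_comm]
  gcongr

lemma gaussian_abs_tail {t : ℝ} (ht : 0 ≤ t) :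
    (gaussianReal 0 1).real {y | t < |y|} ≤ 2 * Real.exp (-(t ^ 2 / 2)) := by
  have hmgf : ∀ u : ℝ, mgf (fun y => y) (gaussianReal 0 1) u = Real.exp (u ^ 2 / 2) := fun u => by
    rw [mgf_fun_id_gaussianReal]; simp
  have h1 : (gaussianReal 0 1).real {y | t ≤ y} ≤ Real.exp (-(t ^ 2 / 2)) := by
    refine (measure_ge_le_exp_mul_mgf t ht (integrable_exp_mul_gaussianReal t)).trans ?_
    rw [hmgf, ← Real.exp_add]
    gcongr
    nlinarith
  have h2 : (gaussianReal 0 1).real {y | y ≤ -t} ≤ Real.exp (-(t ^ 2 / 2)) := by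
    refine (measure_le_le_exp_mul_mgf (-t) (t := -t) (by linarith)
      (integrable_exp_mul_gaussianReal (-t))).trans ?_
    rw [hmgf, ← Real.exp_add]
    gcongr
    nlinarith
  have h3 : {y : ℝ | t < |y|} ⊆ {y | t ≤ y} ∪ {y | y ≤ -t} := fun y hy => by
    rcases lt_abs.1 (show t < |y| from hy) with h | h
    · exact Or.inl h.le
    · exact Or.inr (show y ≤ -t by linarith)
  calc _ ≤ (gaussianReal 0 1).real ({y | t ≤ y} ∪ {y | y ≤ -t}) := measureReal_mono h3
    _ ≤ _ := measureReal_union_le _ _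
    _ ≤ _ := by linarith

lemma stdNoise_abs_tail {t : ℝ} (ht : 0 ≤ t) :
    (stdNoise ι).real {ξ | ∀ i, |ξ i| ≤ t}ᶜ ≤ 2 * Fintype.card ι * Real.exp (-(t ^ 2 / 2)) := by
  have e : ({ξ : ι → ℝ | ∀ i, |ξ i| ≤ t}ᶜ) = ⋃ i, {ξ | t < |ξ i|} := by
    ext ξ; simp
  rw [e]
  refine (measureReal_iUnion_fintype_le _).trans ?_
  calc _ ≤ ∑ _i : ι, 2 * Real.exp (-(t ^ 2 / 2)) := by
        refine Finset.sum_le_sum fun i _ => ?_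
        have hm : MeasurableSet {y : ℝ | t < |y|} :=
          measurableSet_lt measurable_const (by fun_prop)
        have h1 : (stdNoise ι).real {ξ | t < |ξ i|} = (gaussianReal 0 1).real {y | t < |y|} := by
          have := (measurePreserving_eval (fun _ : ι => gaussianReal 0 1) i).measure_preimage
            hm.nullMeasurableSet
          exact congrArg ENNReal.toReal this
        rw [h1]
        exact gaussian_abs_tail ht
    _ = _ := by
        simp only [Finset.sum_const, Finset.card_univ, nsmul_eq_mul]
        ring

/-- From optimism with constant probability to a bound in mean. The event `W` fails with probability
at most `q`, and `A` is the event of optimism. On `W` the loss `f` is at most `Δ⁺ + ψ`, where `Δ` is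
deterministic; on `A ∩ W` already `Δ ≤ ψ`, so Markov's inequality bounds `Δ` by a multiple of the
mean of `ψ`. -/
lemma lintegral_le_of_optimism {Ξ : Type*} [MeasurableSpace Ξ] {ν : Measure Ξ}
    [IsProbabilityMeasure ν] {f ψ : Ξ → ℝ} (hψ : Measurable ψ) (hψ0 : ∀ ξ, 0 ≤ ψ ξ) {A W : Set Ξ}
    (hW : MeasurableSet W) {p q c Δ : ℝ} (hp : 0 < p) (hc : 0 ≤ c)
    (hA : p ≤ ν.real A) (hq : ν.real Wᶜ ≤ q) (hf : ∀ ξ, f ξ ≤ c)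
    (hfW : ∀ ξ ∈ W, f ξ ≤ max Δ 0 + ψ ξ) (hAW : ∀ ξ ∈ A ∩ W, Δ ≤ ψ ξ) :
    ∫⁻ ξ, ENNReal.ofReal (f ξ) ∂ν
      ≤ ENNReal.ofReal (1 + 2 / p) * ∫⁻ ξ, ENNReal.ofReal (ψ ξ) ∂ν
        + ENNReal.ofReal ((1 + 2 / p) * c * q) := by
  have hq0 : 0 ≤ q := measureReal_nonneg.trans hq
  by_cases hbig : p / 2 < q
  · calc _ ≤ ∫⁻ _, ENNReal.ofReal c ∂ν :=
          lintegral_mono fun ξ => ENNReal.ofReal_le_ofReal (hf ξ)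
      _ = ENNReal.ofReal c := by simp
      _ ≤ ENNReal.ofReal ((1 + 2 / p) * c * q) := by
          refine ENNReal.ofReal_le_ofReal ?_
          have h1 : 1 ≤ (2 / p) * q := by
            rw [div_mul_eq_mul_div, le_div_iff₀ hp]; linarith
          have h2 : 1 ≤ (1 + 2 / p) * q := by nlinarith
          nlinarith
      _ ≤ _ := le_add_self
  · have hAWm : p / 2 ≤ ν.real (A ∩ W) := by
      have h1 : ν.real A ≤ ν.real (A ∩ W) + ν.real Wᶜ := by
        refine (measureReal_mono (fun ξ hξ => ?_)).trans (measureReal_union_le _ _)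
        by_cases h : ξ ∈ W
        · exact Or.inl ⟨hξ, h⟩
        · exact Or.inr h
      linarith
    have hMarkov : ENNReal.ofReal Δ * ENNReal.ofReal (p / 2) ≤ ∫⁻ ξ, ENNReal.ofReal (ψ ξ) ∂ν := by
      calc _ ≤ ENNReal.ofReal Δ * ν {ξ | ENNReal.ofReal Δ ≤ ENNReal.ofReal (ψ ξ)} := by
            gcongr
            calc ENNReal.ofReal (p / 2) ≤ ENNReal.ofReal (ν.real (A ∩ W)) :=
                  ENNReal.ofReal_le_ofReal hAWm
              _ = ν (A ∩ W) := ofReal_measureReal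
              _ ≤ _ := measure_mono fun ξ hξ => ENNReal.ofReal_le_ofReal (hAW ξ hξ)
        _ ≤ _ := mul_meas_ge_le_lintegral hψ.ennreal_ofReal _
    have hΔ : ENNReal.ofReal Δ ≤ ENNReal.ofReal (2 / p) * ∫⁻ ξ, ENNReal.ofReal (ψ ξ) ∂ν := by
      calc ENNReal.ofReal Δ
          = ENNReal.ofReal (2 / p) * (ENNReal.ofReal Δ * ENNReal.ofReal (p / 2)) := by
            rw [mul_comm (ENNReal.ofReal Δ), ← mul_assoc, ← ENNReal.ofReal_mul (by positivity)]
            rw [show 2 / p * (p / 2) = 1 by field_simp]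
            simp
        _ ≤ _ := by gcongr
    calc _ ≤ ∫⁻ ξ, (ENNReal.ofReal (ψ ξ)
            + (ENNReal.ofReal Δ + Wᶜ.indicator (fun _ => ENNReal.ofReal c) ξ)) ∂ν := by
          refine lintegral_mono fun ξ => ?_
          dsimp only
          by_cases h : ξ ∈ W
          · rw [Set.indicator_of_notMem (by simpa using h), add_zero]
            calc ENNReal.ofReal (f ξ) ≤ ENNReal.ofReal (ψ ξ + max Δ 0) :=
                  ENNReal.ofReal_le_ofReal (by linarith [hfW ξ h])
              _ = _ := by
                  rw [ENNReal.ofReal_add (hψ0 ξ) (le_max_right _ _)]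
                  congr 1
                  rcases le_total Δ 0 with h0 | h0
                  · rw [max_eq_right h0, ENNReal.ofReal_of_nonpos h0, ENNReal.ofReal_zero]
                  · rw [max_eq_left h0]
          · rw [Set.indicator_of_mem (by simpa using h)]
            calc ENNReal.ofReal (f ξ) ≤ ENNReal.ofReal c := ENNReal.ofReal_le_ofReal (hf ξ)
              _ ≤ _ := le_add_left le_add_self
      _ = ∫⁻ ξ, ENNReal.ofReal (ψ ξ) ∂ν + (ENNReal.ofReal Δ + ENNReal.ofReal c * ν Wᶜ) := by
          rw [lintegral_add_left hψ.ennreal_ofReal, lintegral_add_left measurable_const,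
            lintegral_indicator_const hW.compl]
          simp
      _ ≤ ∫⁻ ξ, ENNReal.ofReal (ψ ξ) ∂ν
          + (ENNReal.ofReal (2 / p) * ∫⁻ ξ, ENNReal.ofReal (ψ ξ) ∂ν
            + ENNReal.ofReal ((1 + 2 / p) * c * q)) := by
          gcongr
          calc ENNReal.ofReal c * ν Wᶜ = ENNReal.ofReal (c * ν.real Wᶜ) := by
                rw [ENNReal.ofReal_mul hc, ofReal_measureReal]
            _ ≤ _ := by
                refine ENNReal.ofReal_le_ofReal ?_
                have h1 : c * ν.real Wᶜ ≤ c * q := by gcongr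
                have h2 : 0 ≤ 2 / p * (c * q) := by positivity
                nlinarith
      _ = _ := by
          rw [ENNReal.ofReal_add zero_le_one (by positivity), ENNReal.ofReal_one,
            add_mul (1 : ℝ≥0∞), one_mul, add_assoc]

end Gaussian

/-! ### The regret of a single episode -/

section SingleEpisode

open scoped ENNReal

variable {H S A : ℕ}

lemma isValueBounded_value (M : MDP H S A) (π : Policy H S A) :
    IsValueBounded H (value M.tabular π) := fun h s =>
  ⟨value_nonneg _ π M.tabular_P_nonneg (fun h s a => (M.tabular_R_mem h s a).1) h s, by
    simpa using value_le_mul_of_substochastic M.tabular π zero_le_one M.tabular_P_nonneg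
      (fun h s a => (M.sum_tabular_P h s a).le) (fun h s a => (M.tabular_R_mem h s a).2) h s⟩

lemma exists_value_eq_optValue [NeZero A] (M : MDP H S A) :
    ∃ π, value M.tabular π 0 M.init = optValue M.tabular 0 M.init := by
  obtain ⟨π, hπ⟩ := Finite.exists_max fun π : Policy H S A => value M.tabular π 0 M.init
  exact ⟨π, le_antisymm (le_ciSup (f := fun π => value M.tabular π 0 M.init)
    (Set.finite_range _).bddAbove π) (ciSup_le hπ)⟩

lemma value_le_optValue (M : MDP H S A) (π : Policy H S A) :
    value M.tabular π 0 M.init ≤ optValue M.tabular 0 M.init :=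
  le_ciSup (f := fun π => value M.tabular π 0 M.init) (Set.finite_range _).bddAbove π

lemma optValue_sub_value_le [NeZero A] (M : MDP H S A) (π : Policy H S A) :
    optValue M.tabular 0 M.init - value M.tabular π 0 M.init ≤ H := by
  obtain ⟨π', hπ'⟩ := exists_value_eq_optValue M
  have h1 := (isValueBounded_value M π' 0 M.init).2
  have h2 := (isValueBounded_value M π 0 M.init).1
  simp only [Nat.sub_zero] at h1
  linarith

/-- The standard deviation of the noise added to an estimated reward. -/
def noiseStd (b : ℝ) {k : ℕ} (D : History H S A k) (h : Fin H) (s : Fin S) (a : Fin A) : ℝ :=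
  √(b / ((visits D h s a : ℝ) + 1))

lemma noiseStd_nonneg (b : ℝ) {k : ℕ} (D : History H S A k) (h : Fin H) (s : Fin S) (a : Fin A) :
    0 ≤ noiseStd b D h s a := Real.sqrt_nonneg _

lemma value_perturbed (b : ℝ) {k : ℕ} (D : History H S A k) (ξ : Fin H × Fin S × Fin A → ℝ)
    (π : Policy H S A) (h : ℕ) (s : Fin S) :
    value (perturbed b D ξ) π h s
      = value ⟨empTrans D, fun h s a => empReward D h s a + noiseStd b D h s a * ξ (h, s, a)⟩
        π h s := rfl

/-- Under a good history the perturbed value of the comparator is at least its true value, up to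
the accumulated noise minus the accumulated estimation error. -/
lemma value_add_le_value_perturbed (M : MDP H S A) (π : Policy H S A) {x b : ℝ} {k : ℕ}
    {D : History H S A k} (hD : IsGood M (value M.tabular π) x D)
    (ξ : Fin H × Fin S × Fin A → ℝ) (h : ℕ) (s : Fin S) :
    value M.tabular π h s
      + value ⟨empTrans D, fun h s a => noiseStd b D h s a * ξ (h, s, a)
          - H * √(x / (visits D h s a + 1))⟩ π h s
      ≤ value (perturbed b D ξ) π h s := by
  rw [value_perturbed]
  refine le_value_of_bellman _ π (fun h s => value M.tabular π h s
      + value ⟨empTrans D, fun h s a => noiseStd b D h s a * ξ (h, s, a)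
          - H * √(x / (visits D h s a + 1))⟩ π h s) (empTrans_nonneg D) (fun h s hh => ?_)
    (fun h hh s => ?_) h s
  · simp [value_of_le _ π hh]
  · have hb := hD.backup ⟨h, hh⟩ s (π ⟨h, hh⟩ s)
    simp only [value_of_lt _ π hh, mul_add, Finset.sum_add_distrib]
    simp only at hb
    linarith

/-- Optimism: with constant probability over the noise, the perturbed value of the comparator is
at least its true value. The occupation weights `d` of the comparator turn the estimation error into
`∑ d e`, which by the Cauchy–Schwarz inequality over the `H S` visited triples is at most three
standard deviations of the accumulated noise. -/
lemma optimismProb_le_value_perturbed (M : MDP H S A) (π : Policy H S A) {x b : ℝ}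
    (hb : (H : ℝ) ^ 3 * S * x ≤ 9 * b) {k : ℕ} {D : History H S A k}
    (hD : IsGood M (value M.tabular π) x D) :
    optimismProb ≤ (stdNoise (Fin H × Fin S × Fin A)).real
      {ξ | value M.tabular π 0 M.init ≤ value (perturbed b D ξ) π 0 M.init} := by
  obtain ⟨d, hd0, hd⟩ := exists_occupancy (empTrans D) (empTrans_nonneg D) π 0 M.init
  let c : Fin H × Fin S × Fin A → ℝ := fun j =>
    if j.2.2 = π j.1 j.2.1 then d j.1 j.2.1 * noiseStd b D j.1 j.2.1 j.2.2 else 0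
  refine (optimismProb_le_sum c).trans (measureReal_mono fun ξ hξ => ?_)
  have hsum : ∑ j, c j * ξ j
      = ∑ i, ∑ t, d i t * (noiseStd b D i t (π i t) * ξ (i, t, π i t)) := by
    rw [Fintype.sum_prod_type]
    refine Finset.sum_congr rfl fun i _ => ?_
    rw [Fintype.sum_prod_type]
    refine Finset.sum_congr rfl fun t _ => ?_
    simp only [c, ite_mul, zero_mul]
    rw [Finset.sum_ite_eq' Finset.univ (π i t)]
    simp [mul_assoc]
  have hsq : ∑ j, c j ^ 2
      = ∑ j : Fin H × Fin S, (d j.1 j.2 * noiseStd b D j.1 j.2 (π j.1 j.2)) ^ 2 := by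
    rw [Fintype.sum_prod_type, Fintype.sum_prod_type]
    refine Finset.sum_congr rfl fun i _ => ?_
    rw [Fintype.sum_prod_type]
    refine Finset.sum_congr rfl fun t _ => ?_
    simp only [c, ite_pow]
    simp
  have herr : ∑ i, ∑ t, d i t * (H * √(x / (visits D i t (π i t) + 1)))
      ≤ 3 * √(∑ j, c j ^ 2) := by
    rcases Nat.eq_zero_or_pos H with h0 | hHpos
    · subst h0; simp
    rcases Nat.eq_zero_or_pos S with h0 | hSpos
    · subst h0; simp
    have hH : (0 : ℝ) < H := by exact_mod_cast hHpos
    have hS : (0 : ℝ) < S := by exact_mod_cast hSpos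
    have hcs : √(H * S) * ∑ i, ∑ t, d i t * (H * √(x / (visits D i t (π i t) + 1)))
        ≤ 3 * ∑ j : Fin H × Fin S, d j.1 j.2 * noiseStd b D j.1 j.2 (π j.1 j.2) := by
      rw [Fintype.sum_prod_type, Finset.mul_sum, Finset.mul_sum]
      refine Finset.sum_le_sum fun i _ => ?_
      rw [Finset.mul_sum, Finset.mul_sum]
      refine Finset.sum_le_sum fun t _ => ?_
      have h1 : √(H * S) * (H * √(x / (visits D i t (π i t) + 1)))
          ≤ 3 * noiseStd b D i t (π i t) := by
        unfold noiseStd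
        have e1 : (H : ℝ) = √(H ^ 2) := (Real.sqrt_sq hH.le).symm
        have e2 : (3 : ℝ) = √9 := by
          rw [show (9 : ℝ) = 3 ^ 2 by norm_num, Real.sqrt_sq (by norm_num)]
        calc √(H * S) * (H * √(x / (visits D i t (π i t) + 1)))
            = √((H ^ 3 * S * x) / (visits D i t (π i t) + 1)) := by
              nth_rewrite 2 [e1]
              rw [← Real.sqrt_mul (by positivity), ← Real.sqrt_mul (by positivity)]
              congr 1
              ring
          _ ≤ √((9 * b) / (visits D i t (π i t) + 1)) := by gcongr
          _ = _ := by
              rw [mul_div_assoc, Real.sqrt_mul (by norm_num), ← e2]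
      calc √(H * S) * (d i t * (H * √(x / (visits D i t (π i t) + 1))))
          = d i t * (√(H * S) * (H * √(x / (visits D i t (π i t) + 1)))) := by ring
        _ ≤ d i t * (3 * noiseStd b D i t (π i t)) :=
            mul_le_mul_of_nonneg_left h1 (hd0 i t)
        _ = _ := by ring
    have hcs2 : ∑ j : Fin H × Fin S, d j.1 j.2 * noiseStd b D j.1 j.2 (π j.1 j.2)
        ≤ √(H * S) * √(∑ j, c j ^ 2) := by
      rw [← Real.sqrt_mul (by positivity), hsq]
      refine Real.le_sqrt_of_sq_le ?_
      have := sq_sum_le_card_mul_sum_sq (s := (Finset.univ : Finset (Fin H × Fin S)))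
        (f := fun j => d j.1 j.2 * noiseStd b D j.1 j.2 (π j.1 j.2))
      simpa using this
    have hpos : 0 < √((H : ℝ) * S) := Real.sqrt_pos.2 (by positivity)
    refine le_of_mul_le_mul_left (hcs.trans ?_) hpos
    linarith
  have hval := value_add_le_value_perturbed (b := b) M π hD ξ 0 M.init
  rw [hd] at hval
  simp only [mul_sub, Finset.sum_sub_distrib] at hval
  rw [← hsum] at hval
  have hξ' : 3 * √(∑ j, c j ^ 2) ≤ ∑ j, c j * ξ j := hξ
  change value M.tabular π 0 M.init ≤ value (perturbed b D ξ) π 0 M.init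
  linarith

/-- The scale of the exploration bonus. -/
def bonusScale (H S : ℕ) (b x : ℝ) : ℝ := 2 * √(2 * x) * √b + (1 + H * S) * √x

/-- The exploration bonus: it dominates both the noise (up to `√(2 x)` standard deviations, twice)
and the errors of the empirical Bellman backups. -/
def bonus (b x : ℝ) {k : ℕ} (D : History H S A k) (h : Fin H) (s : Fin S) (a : Fin A) : ℝ :=
  bonusScale H S b x * (√((visits D h s a : ℝ) + 1))⁻¹

lemma bonusScale_nonneg (H S : ℕ) (b x : ℝ) : 0 ≤ bonusScale H S b x := by
  unfold bonusScale
  positivity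

lemma bonus_nonneg (b x : ℝ) {k : ℕ} (D : History H S A k) (h : Fin H) (s : Fin S) (a : Fin A) :
    0 ≤ bonus b x D h s a :=
  mul_nonneg (bonusScale_nonneg H S b x) (by positivity)

lemma bonus_eq (b x : ℝ) {k : ℕ} (D : History H S A k) (h : Fin H) (s : Fin S) (a : Fin A) :
    bonus b x D h s a = 2 * (√(2 * x) * noiseStd b D h s a)
      + (1 + H * S) * √(x / ((visits D h s a : ℝ) + 1)) := by
  unfold bonus bonusScale noiseStd
  rw [Real.sqrt_div' _ (by positivity), Real.sqrt_div' _ (by positivity)]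
  ring

lemma noise_mul_le {b x : ℝ} {k : ℕ} {D : History H S A k} {ξ : Fin H × Fin S × Fin A → ℝ}
    (hξ : ∀ i, |ξ i| ≤ √(2 * x)) (h : Fin H) (s : Fin S) (a : Fin A) :
    |noiseStd b D h s a * ξ (h, s, a)| ≤ √(2 * x) * noiseStd b D h s a := by
  rw [abs_mul, abs_of_nonneg (noiseStd_nonneg b D h s a), mul_comm]
  exact mul_le_mul_of_nonneg_right (hξ _) (noiseStd_nonneg b D h s a)

/-- Under a good history and bounded noise, the perturbed value of any policy exceeds its true value
by at most the value of the bonus in the empirical model. -/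
lemma value_perturbed_le (M : MDP H S A) (π : Policy H S A) {V : ℕ → Fin S → ℝ} {x b : ℝ} {k : ℕ}
    {D : History H S A k} (hD : IsGood M V x D) {ξ : Fin H × Fin S × Fin A → ℝ}
    (hξ : ∀ i, |ξ i| ≤ √(2 * x)) (h : ℕ) (s : Fin S) :
    value (perturbed b D ξ) π h s
      ≤ value M.tabular π h s + value ⟨empTrans D, bonus b x D⟩ π h s := by
  rw [value_perturbed]
  refine value_le_of_bellman _ π (fun h s => value M.tabular π h s
      + value ⟨empTrans D, bonus b x D⟩ π h s) (empTrans_nonneg D) (fun h s hh => ?_)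
    (fun h hh s => ?_) h s
  · simp [value_of_le _ π hh]
  · set a := π ⟨h, hh⟩ s
    set n := visits D ⟨h, hh⟩ s a with hn
    have h1 := hD.reward ⟨h, hh⟩ s a
    have h2 : ∑ t, empTrans D ⟨h, hh⟩ s a t * value M.tabular π (h + 1) t
        ≤ ∑ t, M.tabular.P ⟨h, hh⟩ s a t * value M.tabular π (h + 1) t
          + H * S * √(x / ((n : ℝ) + 1)) := by
      calc _ ≤ ∑ t, (M.tabular.P ⟨h, hh⟩ s a t * value M.tabular π (h + 1) t
              + √(x / ((n : ℝ) + 1)) * H) := by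
            refine Finset.sum_le_sum fun t _ => ?_
            have hV := isValueBounded_value M π (h + 1) t
            have hV2 : value M.tabular π (h + 1) t ≤ H := hV.2.trans (by
              exact_mod_cast Nat.sub_le _ _)
            have h3 := mul_le_mul_of_nonneg_right (hD.trans ⟨h, hh⟩ s a t) hV.1
            have h4 := mul_le_mul_of_nonneg_left hV2 (Real.sqrt_nonneg (x / ((n : ℝ) + 1)))
            rw [add_mul] at h3
            linarith
        _ = _ := by
            rw [Finset.sum_add_distrib]
            simp only [Finset.sum_const, Finset.card_univ, Fintype.card_fin, nsmul_eq_mul]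
            ring
    have h3 := (abs_le.1 (noise_mul_le (b := b) (D := D) hξ ⟨h, hh⟩ s a)).2
    have h4 := bonus_eq b x D ⟨h, hh⟩ s a
    have h5 : 0 ≤ √(2 * x) * noiseStd b D ⟨h, hh⟩ s a :=
      mul_nonneg (Real.sqrt_nonneg _) (noiseStd_nonneg _ _ _ _ _)
    simp only [value_of_lt _ π hh, mul_add, Finset.sum_add_distrib]
    rw [h4]
    simp only [← hn] at h1 ⊢
    linarith

/-- Under a good history, the mean regret of the next episode is bounded by the mean value, in the
empirical model, of the bonus collected by the selected policy. The deterministic benchmark is the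
optimal value of the empirical model whose rewards are lowered by `√(2 x)` standard deviations. -/
lemma lintegral_gap_le [NeZero A] (M : MDP H S A) {π₀ : Policy H S A}
    (hπ₀ : value M.tabular π₀ 0 M.init = optValue M.tabular 0 M.init) {x b : ℝ} (hx : 0 ≤ x)
    (hb : (H : ℝ) ^ 3 * S * x ≤ 9 * b) {k : ℕ} {D : History H S A k}
    (hD : IsGood M (value M.tabular π₀) x D)
    {sel : (Fin H × Fin S × Fin A → ℝ) → Policy H S A} (hsel : Measurable sel)
    (hopt : ∀ ξ, IsOptimal (perturbed b D ξ) (sel ξ)) :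
    ∫⁻ ξ, ENNReal.ofReal (optValue M.tabular 0 M.init - value M.tabular (sel ξ) 0 M.init)
        ∂(stdNoise (Fin H × Fin S × Fin A))
      ≤ ENNReal.ofReal (1 + 2 / optimismProb)
        * ∫⁻ ξ, ENNReal.ofReal (value ⟨empTrans D, bonus b x D⟩ (sel ξ) 0 M.init)
          ∂(stdNoise (Fin H × Fin S × Fin A))
        + ENNReal.ofReal ((1 + 2 / optimismProb) * H * (2 * (H * S * A) * Real.exp (-x))) := by
  let lower : Tabular H S A :=
    ⟨empTrans D, fun h s a => empReward D h s a - √(2 * x) * noiseStd b D h s a⟩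
  obtain ⟨π₁, hπ₁⟩ := Finite.exists_max fun π : Policy H S A => value lower π 0 M.init
  let W : Set (Fin H × Fin S × Fin A → ℝ) := {ξ | ∀ i, |ξ i| ≤ √(2 * x)}
  have hW : MeasurableSet W := by
    have : W = ⋂ i, {ξ | |ξ i| ≤ √(2 * x)} := by ext ξ; simp [W]
    rw [this]
    exact MeasurableSet.iInter fun i => measurableSet_le (by fun_prop) measurable_const
  refine lintegral_le_of_optimism (ν := stdNoise (Fin H × Fin S × Fin A))
    (A := {ξ | value M.tabular π₀ 0 M.init ≤ value (perturbed b D ξ) π₀ 0 M.init}) (W := W)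
    (p := optimismProb) (Δ := optValue M.tabular 0 M.init - value lower π₁ 0 M.init)
    ((measurable_of_finite fun π => value ⟨empTrans D, bonus b x D⟩ π 0 M.init).comp hsel)
    (fun ξ => value_nonneg _ _ (empTrans_nonneg D) (bonus_nonneg b x D) 0 M.init) hW
    optimismProb_pos (Nat.cast_nonneg H) (optimismProb_le_value_perturbed M π₀ hb hD) ?_
    (fun ξ => optValue_sub_value_le M _) (fun ξ hξ => ?_) (fun ξ hξ => ?_)
  · refine (stdNoise_abs_tail (ι := Fin H × Fin S × Fin A) (Real.sqrt_nonneg (2 * x))).trans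
      (le_of_eq ?_)
    rw [Real.sq_sqrt (by positivity)]
    simp only [Fintype.card_prod, Fintype.card_fin]
    push_cast
    ring_nf
  · have h1 : value lower π₁ 0 M.init ≤ value (perturbed b D ξ) π₁ 0 M.init := by
      rw [value_perturbed]
      refine value_mono_reward π₁ (empTrans_nonneg D) (fun h s a => ?_) 0 M.init
      have := (abs_le.1 (noise_mul_le (b := b) (D := D) hξ h s a)).1
      linarith
    have h2 := hopt ξ 0 M.init π₁
    have h3 := value_perturbed_le (b := b) M (sel ξ) hD hξ 0 M.init
    have h4 := le_max_left (optValue M.tabular 0 M.init - value lower π₁ 0 M.init) 0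
    simp only [Function.comp_apply]
    linarith
  · obtain ⟨hA, hξ⟩ := hξ
    have h1 : value (perturbed b D ξ) (sel ξ) 0 M.init
        ≤ value lower (sel ξ) 0 M.init
          + value ⟨empTrans D, bonus b x D⟩ (sel ξ) 0 M.init := by
      rw [value_perturbed, ← value_add_reward]
      refine value_mono_reward _ (empTrans_nonneg D) (fun h s a => ?_) 0 M.init
      have h2 := (abs_le.1 (noise_mul_le (b := b) (D := D) hξ h s a)).2
      have h3 : 0 ≤ (1 + H * S) * √(x / ((visits D h s a : ℝ) + 1)) := by positivity
      rw [bonus_eq]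
      linarith
    have h2 := hopt ξ 0 M.init π₀
    have h3 := hπ₁ (sel ξ)
    have hA' : value M.tabular π₀ 0 M.init ≤ value (perturbed b D ξ) π₀ 0 M.init := hA
    simp only [Function.comp_apply]
    linarith

/-- The scale of the second-order term that arises when empirical transitions are replaced by the
true ones. -/
def secondScale (H S : ℕ) (b x : ℝ) : ℝ := 2 * H ^ 2 * S * x * bonusScale H S b x

/-- Under a good history, the value of the bonus in the empirical model is at most three times the
value, in the true model, of the bonus plus a second-order term. The multiplicative bound
`P̂ ≤ (1 + 1/H) P + O(H x / n)` loses only the factor `(1 + 1/H) ^ H ≤ 3` over the episode, and its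
additive error multiplies the crude bound `H * bonusScale` on the value of the bonus. -/
lemma value_bonus_le (M : MDP H S A) (π : Policy H S A) {V : ℕ → Fin S → ℝ} {x b : ℝ}
    (hx : 0 ≤ x) {k : ℕ} {D : History H S A k} (hD : IsGood M V x D) (s : Fin S) :
    value ⟨empTrans D, bonus b x D⟩ π 0 s
      ≤ 3 * (bonusScale H S b x
          * value ⟨M.tabular.P, fun h s a => (√((visits D h s a : ℝ) + 1))⁻¹⟩ π 0 s
        + secondScale H S b x
          * value ⟨M.tabular.P, fun h s a => ((visits D h s a : ℝ) + 1)⁻¹⟩ π 0 s) := by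
  have hG := bonusScale_nonneg H S b x
  have hG2 : 0 ≤ secondScale H S b x := by unfold secondScale; positivity
  have hU0 : ∀ h s, 0 ≤ value ⟨empTrans D, bonus b x D⟩ π h s := fun h s =>
    value_nonneg _ π (empTrans_nonneg D) (bonus_nonneg b x D) h s
  have hU : ∀ h s, value ⟨empTrans D, bonus b x D⟩ π h s ≤ bonusScale H S b x * H := fun h s => by
    refine (value_le_mul_of_substochastic _ π hG (empTrans_nonneg D) (sum_empTrans_le_one D)
      (fun h s a => ?_) h s).trans ?_
    · refine mul_le_of_le_one_right hG (inv_le_one_of_one_le₀ ?_)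
      exact Real.one_le_sqrt.2 (by linarith [(Nat.cast_nonneg (visits D h s a) : (0 : ℝ) ≤ _)])
    · gcongr
      exact Nat.sub_le _ _
  obtain ⟨R', hR'⟩ : ∃ R' : Fin H → Fin S → Fin A → ℝ, R' = fun h s a =>
    bonusScale H S b x * (√((visits D h s a : ℝ) + 1))⁻¹
      + secondScale H S b x * ((visits D h s a : ℝ) + 1)⁻¹ := ⟨_, rfl⟩
  have hR'eq : ∀ h s a, R' h s a = bonusScale H S b x * (√((visits D h s a : ℝ) + 1))⁻¹
      + secondScale H S b x * ((visits D h s a : ℝ) + 1)⁻¹ := fun h s a => by rw [hR']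
  have hR'0 : ∀ h s a, 0 ≤ R' h s a := fun h s a => by
    rw [hR'eq]
    positivity
  have hT0 : ∀ h s, 0 ≤ value ⟨M.tabular.P, R'⟩ π h s := fun h s =>
    value_nonneg ⟨M.tabular.P, R'⟩ π M.tabular_P_nonneg hR'0 h s
  have key : ∀ h : ℕ, ∀ s, value ⟨empTrans D, bonus b x D⟩ π h s
      ≤ (1 + 1 / (H : ℝ)) ^ (H - h) * value ⟨M.tabular.P, R'⟩ π h s := by
    refine backward_induction (H := H) ?_ ?_
    · intro h hh s
      simp [value_of_le _ π hh]
    · intro h hh ih s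
      have hHpos : (0 : ℝ) < H := by exact_mod_cast (Nat.zero_le h).trans_lt hh
      rw [value_of_lt _ π hh, value_of_lt _ π hh]
      set a := π ⟨h, hh⟩ s
      set c := (1 + 1 / (H : ℝ)) with hc
      have hc1 : 1 ≤ c := by rw [hc]; linarith [(by positivity : 0 ≤ 1 / (H : ℝ))]
      have hstep : ∀ t, empTrans D ⟨h, hh⟩ s a t * value ⟨empTrans D, bonus b x D⟩ π (h + 1) t
          ≤ c * (M.tabular.P ⟨h, hh⟩ s a t
              * (c ^ (H - (h + 1)) * value ⟨M.tabular.P, R'⟩ π (h + 1) t))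
            + 2 * H * x / ((visits D ⟨h, hh⟩ s a : ℝ) + 1) * (bonusScale H S b x * H) := fun t => by
        have h1 := mul_le_mul_of_nonneg_right (hD.trans_mul ⟨h, hh⟩ s a t) (hU0 (h + 1) t)
        have h2 := mul_le_mul_of_nonneg_left (ih t)
          (mul_nonneg (by positivity : 0 ≤ c) (M.tabular_P_nonneg ⟨h, hh⟩ s a t))
        have h3 := mul_le_mul_of_nonneg_left (hU (h + 1) t)
          (by positivity : 0 ≤ 2 * H * x / ((visits D ⟨h, hh⟩ s a : ℝ) + 1))
        rw [add_mul] at h1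
        linarith
      have hpow : c * c ^ (H - (h + 1)) = c ^ (H - h) := by
        rw [← pow_succ', show H - (h + 1) + 1 = H - h by omega]
      calc _ ≤ bonus b x D ⟨h, hh⟩ s a
            + ∑ t, (c * (M.tabular.P ⟨h, hh⟩ s a t
              * (c ^ (H - (h + 1)) * value ⟨M.tabular.P, R'⟩ π (h + 1) t))
            + 2 * H * x / ((visits D ⟨h, hh⟩ s a : ℝ) + 1) * (bonusScale H S b x * H)) := by
            gcongr with t _
            exact hstep t
        _ = R' ⟨h, hh⟩ s a
            + c ^ (H - h) * ∑ t, M.tabular.P ⟨h, hh⟩ s a t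
              * value ⟨M.tabular.P, R'⟩ π (h + 1) t := by
            rw [Finset.sum_add_distrib, ← hpow, Finset.mul_sum]
            simp only [Finset.sum_const, Finset.card_univ, Fintype.card_fin, nsmul_eq_mul, hR'eq,
              bonus, secondScale]
            have : ∑ t, c * (M.tabular.P ⟨h, hh⟩ s a t
                  * (c ^ (H - (h + 1)) * value ⟨M.tabular.P, R'⟩ π (h + 1) t))
                = ∑ t, c * c ^ (H - (h + 1))
                  * (M.tabular.P ⟨h, hh⟩ s a t * value ⟨M.tabular.P, R'⟩ π (h + 1) t) :=
              Finset.sum_congr rfl fun t _ => by ring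
            rw [this]
            ring
        _ ≤ c ^ (H - h) * R' ⟨h, hh⟩ s a
            + c ^ (H - h) * ∑ t, M.tabular.P ⟨h, hh⟩ s a t
              * value ⟨M.tabular.P, R'⟩ π (h + 1) t := by
            gcongr
            exact le_mul_of_one_le_left (hR'0 _ _ _) (one_le_pow₀ hc1)
        _ = _ := by ring
  have hexp : (1 + 1 / (H : ℝ)) ^ H ≤ 3 := by
    rcases Nat.eq_zero_or_pos H with h0 | hHpos
    · subst h0; norm_num
    have hH : (0 : ℝ) < H := by exact_mod_cast hHpos
    calc (1 + 1 / (H : ℝ)) ^ H ≤ (Real.exp (1 / H)) ^ H := by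
          gcongr
          linarith [Real.add_one_le_exp (1 / (H : ℝ))]
      _ = Real.exp 1 := by
          rw [← Real.exp_nat_mul]
          congr 1
          field_simp
      _ ≤ 3 := by linarith [Real.exp_one_lt_d9]
  calc _ ≤ (1 + 1 / (H : ℝ)) ^ H * value ⟨M.tabular.P, R'⟩ π 0 s := by simpa using key 0 s
    _ ≤ 3 * value ⟨M.tabular.P, R'⟩ π 0 s := by
        gcongr
        exact hT0 0 s
    _ = _ := by
        rw [hR', value_add_reward, value_smul_reward, value_smul_reward]

end SingleEpisode

/-! ### Visit counts along the episodes -/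

section Potential

open scoped ENNReal

variable {H S A : ℕ}

lemma sum_sum_ite_eq_and (s₀ : Fin S) (a₀ : Fin A) {α : Type*} [AddCommMonoid α]
    (f : Fin S → Fin A → α) :
    ∑ s, ∑ a, (if s₀ = s ∧ a₀ = a then f s a else 0) = f s₀ a₀ := by
  have h : ∀ s, ∑ a, (if s₀ = s ∧ a₀ = a then f s a else 0) = if s₀ = s then f s a₀ else 0 :=
    fun s => by by_cases hs : s₀ = s <;> simp [hs]
  simp [h]

lemma measurable_comp_visits {k : ℕ} (g : ℕ → ℝ) (h : Fin H) (s : Fin S) (a : Fin A) :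
    Measurable fun D : History H S A k => g (visits D h s a) :=
  (measurable_from_top (f := g)).comp (measurable_visits h s a)

lemma measurable_value_visits (M : MDP H S A) {k : ℕ} (g : ℕ → ℝ) (π : Policy H S A) :
    Measurable fun D : History H S A k => ENNReal.ofReal
      (value ⟨M.tabular.P, fun h s a => g (visits D h s a)⟩ π 0 M.init) :=
  (measurable_value (fun D : History H S A k =>
    (⟨M.tabular.P, fun h s a => g (visits D h s a)⟩ : Tabular H S A))
    (fun _ _ _ _ => measurable_const) (fun h s a => measurable_comp_visits g h s a) π 0
    M.init).ennreal_ofReal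

/-- If `g` is bounded by the increments of `φ`, then the sum of `g (visits)` over all triples played
in `K` episodes is at most the sum of `φ (visits)` at the end. -/
lemma sum_expectNext_value_visits_le (M : MDP H S A) (alg : Algorithm H S A) {φ g : ℕ → ℝ}
    (hg : ∀ n, 0 ≤ g n) (hφ : ∀ n, 0 ≤ φ n) (hstep : ∀ n, φ n + g n ≤ φ (n + 1)) (K : ℕ) {B : ℝ}
    (hB : ∀ D : History H S A K, ∑ h, ∑ s, ∑ a, φ (visits D h s a) ≤ B) :
    ∑ k ∈ Finset.range K, expectNext M alg k (fun D π => ENNReal.ofReal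
      (value ⟨M.tabular.P, fun h s a => g (visits D h s a)⟩ π 0 M.init)) ≤ ENNReal.ofReal B := by
  have hm : ∀ k, Measurable fun D : History H S A k => ∑ h, ∑ s, ∑ a, φ (visits D h s a) :=
    fun k => Finset.measurable_fun_sum _ fun h _ => Finset.measurable_fun_sum _ fun s _ =>
      Finset.measurable_fun_sum _ fun a _ => measurable_comp_visits φ h s a
  refine (sum_expectNext_le_of_potential M alg
    (fun k D => ENNReal.ofReal (∑ h, ∑ s, ∑ a, φ (visits D h s a)))
    (fun k => (hm k).ennreal_ofReal) _ (fun k D π => ?_) K).trans ?_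
  · rw [ofReal_value_eq_sum_lintegral M π _ fun h s a => hg _]
    have hm2 : ∀ h : Fin H, Measurable fun e : Episode H S A =>
        ENNReal.ofReal (g (visits D h (e h).1 (e h).2.1)) := fun h =>
      (measurable_of_finite fun x : Fin S × Fin A => ENNReal.ofReal (g (visits D h x.1 x.2))).comp
        (f := fun e : Episode H S A => ((e h).1, (e h).2.1)) (by fun_prop)
    rw [← lintegral_finsetSum _ fun h _ => hm2 h]
    have hconst : ENNReal.ofReal (∑ h, ∑ s, ∑ a, φ (visits D h s a))
        = ∫⁻ _, ENNReal.ofReal (∑ h, ∑ s, ∑ a, φ (visits D h s a)) ∂(episodeLaw M π) := by simp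
    rw [hconst, ← lintegral_add_left measurable_const]
    refine lintegral_mono fun e => ?_
    dsimp only
    rw [← ENNReal.ofReal_sum_of_nonneg fun h _ => hg _, ← ENNReal.ofReal_add
      (Finset.sum_nonneg fun h _ => Finset.sum_nonneg fun s _ => Finset.sum_nonneg fun a _ => hφ _)
      (Finset.sum_nonneg fun h _ => hg _)]
    refine ENNReal.ofReal_le_ofReal ?_
    rw [← Finset.sum_add_distrib]
    refine Finset.sum_le_sum fun h _ => ?_
    have e1 : g (visits D h (e h).1 (e h).2.1)
        = ∑ s, ∑ a, if (e h).1 = s ∧ (e h).2.1 = a then g (visits D h s a) else 0 :=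
      (sum_sum_ite_eq_and (e h).1 (e h).2.1 fun s a => g (visits D h s a)).symm
    rw [e1, ← Finset.sum_add_distrib]
    refine Finset.sum_le_sum fun s _ => ?_
    rw [← Finset.sum_add_distrib]
    refine Finset.sum_le_sum fun a _ => ?_
    rw [visits_snoc]
    split_ifs
    · exact hstep _
    · simp
  · unfold expectHistory
    calc _ ≤ ∫⁻ _, ENNReal.ofReal B ∂(runLaw M alg K) :=
          lintegral_mono fun ω => ENNReal.ofReal_le_ofReal (hB _)
      _ = _ := by simp

lemma sum_visits {k : ℕ} (D : History H S A k) (h : Fin H) :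
    ∑ s, ∑ a, visits D h s a = k := by
  unfold visits
  calc _ = ∑ i : Fin k, ∑ s, ∑ a, (if (D i h).1 = s ∧ (D i h).2.1 = a then 1 else 0) :=
        (Finset.sum_congr rfl fun s _ => Finset.sum_comm).trans Finset.sum_comm
    _ = ∑ _i : Fin k, 1 := Finset.sum_congr rfl fun i _ => sum_sum_ite_eq_and _ _ fun _ _ => 1
    _ = k := by simp

lemma two_sqrt_add_inv_sqrt_le (n : ℕ) :
    2 * √(n : ℝ) + (√((n : ℝ) + 1))⁻¹ ≤ 2 * √((n + 1 : ℕ) : ℝ) := by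
  push_cast
  have hu := Real.sq_sqrt (Nat.cast_nonneg n : (0 : ℝ) ≤ n)
  have hv := Real.sq_sqrt (by positivity : (0 : ℝ) ≤ (n : ℝ) + 1)
  have hpos : 0 < √((n : ℝ) + 1) := Real.sqrt_pos.2 (by positivity)
  rw [← sub_nonneg]
  have e : 2 * √((n : ℝ) + 1) - (2 * √(n : ℝ) + (√((n : ℝ) + 1))⁻¹)
      = (√((n : ℝ) + 1) - √(n : ℝ)) ^ 2 / √((n : ℝ) + 1) := by
    field_simp
    nlinarith
  rw [e]
  positivity

lemma two_log_add_inv_le (n : ℕ) :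
    2 * Real.log ((n : ℝ) + 1) + ((n : ℝ) + 1)⁻¹ ≤ 2 * Real.log (((n + 1 : ℕ) : ℝ) + 1) := by
  push_cast
  have h1 := Real.one_sub_inv_le_log_of_pos
    (show (0 : ℝ) < ((n : ℝ) + 1 + 1) / ((n : ℝ) + 1) by positivity)
  rw [Real.log_div (by positivity) (by positivity), inv_div] at h1
  have h2 : ((n : ℝ) + 1)⁻¹ ≤ 2 * (1 - ((n : ℝ) + 1) / ((n : ℝ) + 1 + 1)) := by
    rw [← sub_nonneg]
    have e : 2 * (1 - ((n : ℝ) + 1) / ((n : ℝ) + 1 + 1)) - ((n : ℝ) + 1)⁻¹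
        = n / (((n : ℝ) + 1) * ((n : ℝ) + 1 + 1)) := by
      field_simp
      ring
    rw [e]
    positivity
  linarith

lemma sum_expectNext_inv_sqrt_le (M : MDP H S A) (alg : Algorithm H S A) (K : ℕ) :
    ∑ k ∈ Finset.range K, expectNext M alg k (fun D π => ENNReal.ofReal
      (value ⟨M.tabular.P, fun h s a => (√((visits D h s a : ℝ) + 1))⁻¹⟩ π 0 M.init))
      ≤ ENNReal.ofReal (2 * H * √(S * A * K)) := by
  refine sum_expectNext_value_visits_le M alg (φ := fun n => 2 * √(n : ℝ))
    (g := fun n => (√((n : ℝ) + 1))⁻¹) (fun n => by positivity) (fun n => by positivity)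
    two_sqrt_add_inv_sqrt_le K fun D => ?_
  have key : ∀ h : Fin H, ∑ s, ∑ a, 2 * √(visits D h s a : ℝ) ≤ 2 * √(S * A * K) := fun h => by
    have h1 : ∑ j : Fin S × Fin A, √(visits D h j.1 j.2 : ℝ) ≤ √(S * A * K) := by
      refine Real.le_sqrt_of_sq_le ?_
      have h2 := sq_sum_le_card_mul_sum_sq (s := (Finset.univ : Finset (Fin S × Fin A)))
        (f := fun j => √(visits D h j.1 j.2 : ℝ))
      have h3 : ∑ j : Fin S × Fin A, √(visits D h j.1 j.2 : ℝ) ^ 2 = K := by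
        have := sum_visits D h
        simp only [Real.sq_sqrt (Nat.cast_nonneg _)]
        rw [Fintype.sum_prod_type]
        exact_mod_cast this
      rw [h3] at h2
      simpa using h2
    rw [Fintype.sum_prod_type] at h1
    simp only [← Finset.mul_sum]
    linarith
  calc _ ≤ ∑ _h : Fin H, 2 * √(S * A * K : ℝ) := Finset.sum_le_sum fun h _ => key h
    _ = _ := by
      simp only [Finset.sum_const, Finset.card_univ, Fintype.card_fin, nsmul_eq_mul]
      ring

lemma sum_expectNext_inv_le (M : MDP H S A) (alg : Algorithm H S A) (K : ℕ) :
    ∑ k ∈ Finset.range K, expectNext M alg k (fun D π => ENNReal.ofReal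
      (value ⟨M.tabular.P, fun h s a => ((visits D h s a : ℝ) + 1)⁻¹⟩ π 0 M.init))
      ≤ ENNReal.ofReal (2 * (H * S * A) * Real.log (K + 1)) := by
  refine sum_expectNext_value_visits_le M alg (φ := fun n => 2 * Real.log ((n : ℝ) + 1))
    (g := fun n => ((n : ℝ) + 1)⁻¹) (fun n => by positivity)
    (fun n => mul_nonneg zero_le_two (Real.log_nonneg (by simp)))
    two_log_add_inv_le K fun D => ?_
  calc _ ≤ ∑ _h : Fin H, ∑ _s : Fin S, ∑ _a : Fin A, 2 * Real.log ((K : ℝ) + 1) := by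
        refine Finset.sum_le_sum fun h _ => Finset.sum_le_sum fun s _ =>
          Finset.sum_le_sum fun a _ => ?_
        have := visits_le D h s a
        gcongr
    _ = _ := by
        simp only [Finset.sum_const, Finset.card_univ, Fintype.card_fin, nsmul_eq_mul]
        ring

lemma sum_inv_sqrt_le (K : ℕ) :
    ∑ k ∈ Finset.range K, (√((k : ℝ) + 1))⁻¹ ≤ 2 * √(K : ℝ) := by
  induction K with
  | zero => simp
  | succ K ih =>
    rw [Finset.sum_range_succ]
    linarith [two_sqrt_add_inv_sqrt_le K]

end Potential

/-! ### Summing the regret over the episodes -/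

section Total

open scoped ENNReal

variable {H S A : ℕ}

lemma isOptimal_select [NeZero A] (β : ℕ → ℝ) (pick : Set (Policy H S A) → Policy H S A)
    (hpick : ∀ T : Set (Policy H S A), T.Nonempty → pick T ∈ T) (k : ℕ) (D : History H S A k)
    (ξ : Fin H × Fin S × Fin A → ℝ) :
    IsOptimal (perturbed (β (k + 1)) D ξ) ((rlsvi β pick).select k D ξ) := by
  have h := hpick {π | IsOptimal (perturbed (β (k + 1)) D ξ) π}
    (exists_isOptimal _ (empTrans_nonneg D))
  rwa [Set.mem_ofPred_eq] at h

lemma measurable_select_seed (alg : Algorithm H S A) (k : ℕ) (D : History H S A k) :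
    Measurable (alg.select k D) :=
  (alg.measurable_select k).comp (measurable_const.prodMk measurable_id)

/-- `lintegral_gap_le` for the policies selected by `rlsvi`. -/
lemma lintegral_gap_rlsvi_le [NeZero A] (M : MDP H S A) (β : ℕ → ℝ)
    (pick : Set (Policy H S A) → Policy H S A)
    (hpick : ∀ T : Set (Policy H S A), T.Nonempty → pick T ∈ T) {π₀ : Policy H S A}
    (hπ₀ : value M.tabular π₀ 0 M.init = optValue M.tabular 0 M.init) {x : ℝ} (hx : 0 ≤ x)
    {k : ℕ} (hb : (H : ℝ) ^ 3 * S * x ≤ 9 * β (k + 1)) {D : History H S A k}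
    (hD : IsGood M (value M.tabular π₀) x D) :
    ∫⁻ ξ, ENNReal.ofReal (optValue M.tabular 0 M.init
        - value M.tabular ((rlsvi β pick).select k D ξ) 0 M.init) ∂(rlsvi β pick).seedLaw
      ≤ ENNReal.ofReal (1 + 2 / optimismProb)
        * ∫⁻ ξ, ENNReal.ofReal (value ⟨empTrans D, bonus (β (k + 1)) x D⟩
            ((rlsvi β pick).select k D ξ) 0 M.init) ∂(rlsvi β pick).seedLaw
        + ENNReal.ofReal ((1 + 2 / optimismProb) * H * (2 * (H * S * A) * Real.exp (-x))) := by
  have hsel := measurable_select_seed (rlsvi β pick) k D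
  exact lintegral_gap_le M hπ₀ hx hb hD hsel (isOptimal_select β pick hpick k D)

/-- The mean regret of the episode after `k` others, for confidence parameter `x`. -/
lemma expectNext_gap_le [NeZero A] (M : MDP H S A) (alg : Algorithm H S A) {π₀ : Policy H S A}
    {b x G G₂ : ℝ} (hx : 1 ≤ x) (k : ℕ)
    (hgood : ∀ D : History H S A k, IsGood M (value M.tabular π₀) x D →
      ∫⁻ ξ, ENNReal.ofReal (optValue M.tabular 0 M.init
          - value M.tabular (alg.select k D ξ) 0 M.init) ∂alg.seedLaw
        ≤ ENNReal.ofReal (1 + 2 / optimismProb)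
          * ∫⁻ ξ, ENNReal.ofReal (value ⟨empTrans D, bonus b x D⟩ (alg.select k D ξ) 0 M.init)
            ∂alg.seedLaw
          + ENNReal.ofReal ((1 + 2 / optimismProb) * H * (2 * (H * S * A) * Real.exp (-x))))
    (hG : bonusScale H S b x ≤ G)
    (hG₂ : secondScale H S b x ≤ G₂) :
    expectNext M alg k (fun _ π => ENNReal.ofReal
        (optValue M.tabular 0 M.init - value M.tabular π 0 M.init))
      ≤ ENNReal.ofReal (3 * (1 + 2 / optimismProb) * G)
          * expectNext M alg k (fun D π => ENNReal.ofReal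
            (value ⟨M.tabular.P, fun h s a => (√((visits D h s a : ℝ) + 1))⁻¹⟩ π 0 M.init))
        + ENNReal.ofReal (3 * (1 + 2 / optimismProb) * G₂)
          * expectNext M alg k (fun D π => ENNReal.ofReal
            (value ⟨M.tabular.P, fun h s a => ((visits D h s a : ℝ) + 1)⁻¹⟩ π 0 M.init))
        + ENNReal.ofReal (H * (Real.exp (-x) * (H * S * A * (k * (S + 2) + S)))
          + (1 + 2 / optimismProb) * H * (2 * (H * S * A) * Real.exp (-x))) := by
  classical
  set C := 1 + 2 / optimismProb with hC
  have hC0 : 0 ≤ C := by have := optimismProb_pos; positivity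
  have hV := isValueBounded_value M π₀
  have hG0 : 0 ≤ G := (bonusScale_nonneg H S _ x).trans hG
  have hG20 : 0 ≤ G₂ := by
    refine le_trans ?_ hG₂
    have := bonusScale_nonneg H S b x
    unfold secondScale
    positivity
  let F₁ : History H S A k → Policy H S A → ℝ≥0∞ := fun D π => ENNReal.ofReal
    (value ⟨M.tabular.P, fun h s a => (√((visits D h s a : ℝ) + 1))⁻¹⟩ π 0 M.init)
  let F₂ : History H S A k → Policy H S A → ℝ≥0∞ := fun D π => ENNReal.ofReal
    (value ⟨M.tabular.P, fun h s a => ((visits D h s a : ℝ) + 1)⁻¹⟩ π 0 M.init)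
  have hF₁ : ∀ π, Measurable fun D => F₁ D π := fun π =>
    measurable_value_visits M (fun n => (√((n : ℝ) + 1))⁻¹) π
  have hF₂ : ∀ π, Measurable fun D => F₂ D π := fun π =>
    measurable_value_visits M (fun n => ((n : ℝ) + 1)⁻¹) π
  let F : History H S A k → Policy H S A → ℝ≥0∞ := fun D π =>
    ENNReal.ofReal (3 * C * G) * F₁ D π + ENNReal.ofReal (3 * C * G₂) * F₂ D π
  have hF : ∀ π, Measurable fun D => F D π := fun π =>
    ((hF₁ π).const_mul _).add ((hF₂ π).const_mul _)
  have hEF : expectNext M alg k F = ENNReal.ofReal (3 * C * G) * expectNext M alg k F₁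
      + ENNReal.ofReal (3 * C * G₂) * expectNext M alg k F₂ := by
    rw [← expectNext_const_mul M alg k _ hF₁, ← expectNext_const_mul M alg k _ hF₂]
    exact expectNext_add M alg k (fun π => (hF₁ π).const_mul _) _
  have hpoint : ∀ D : History H S A k,
      ∫⁻ ξ, ENNReal.ofReal (optValue M.tabular 0 M.init
          - value M.tabular (alg.select k D ξ) 0 M.init) ∂alg.seedLaw
        ≤ ∫⁻ ξ, F D (alg.select k D ξ) ∂alg.seedLaw
          + (ENNReal.ofReal (C * H * (2 * (H * S * A) * Real.exp (-x)))
            + ENNReal.ofReal H * if IsGood M (value M.tabular π₀) x D then 0 else 1) := by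
    intro D
    by_cases hD : IsGood M (value M.tabular π₀) x D
    · rw [if_pos hD, mul_zero, add_zero]
      refine (hgood D hD).trans ?_
      gcongr
      rw [← lintegral_const_mul _ (f := fun ξ => ENNReal.ofReal
        (value ⟨empTrans D, bonus b x D⟩ (alg.select k D ξ) 0 M.init))
        ((measurable_of_finite fun π => ENNReal.ofReal
        (value ⟨empTrans D, bonus (b) x D⟩ π 0 M.init)).comp
          (measurable_select_seed alg k D))]
      refine lintegral_mono fun ξ => ?_
      simp only [F, F₁, F₂]
      set π := alg.select k D ξ
      have hv1 : 0 ≤ value ⟨M.tabular.P, fun h s a => (√((visits D h s a : ℝ) + 1))⁻¹⟩ π 0 M.init :=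
        value_nonneg ⟨M.tabular.P, fun h s a => (√((visits D h s a : ℝ) + 1))⁻¹⟩ π
          M.tabular_P_nonneg (fun h s a => by positivity) 0 M.init
      have hv2 : 0 ≤ value ⟨M.tabular.P, fun h s a => ((visits D h s a : ℝ) + 1)⁻¹⟩ π 0 M.init :=
        value_nonneg ⟨M.tabular.P, fun h s a => ((visits D h s a : ℝ) + 1)⁻¹⟩ π
          M.tabular_P_nonneg (fun h s a => by positivity) 0 M.init
      have h2 := value_bonus_le (b := b) M π (by linarith : 0 ≤ x) hD M.init
      rw [← ENNReal.ofReal_mul hC0, ← ENNReal.ofReal_mul (by positivity),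
        ← ENNReal.ofReal_mul (by positivity), ← ENNReal.ofReal_add (by positivity) (by positivity)]
      refine ENNReal.ofReal_le_ofReal ?_
      have h3 := mul_le_mul_of_nonneg_right hG hv1
      have h4 := mul_le_mul_of_nonneg_right hG₂ hv2
      have h5 := mul_le_mul_of_nonneg_left (h2.trans (mul_le_mul_of_nonneg_left
        (add_le_add h3 h4) (by norm_num : (0 : ℝ) ≤ 3))) hC0
      refine h5.trans (le_of_eq ?_)
      ring
    · rw [if_neg hD, mul_one]
      calc _ ≤ ∫⁻ _, ENNReal.ofReal H ∂alg.seedLaw :=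
            lintegral_mono fun ξ => ENNReal.ofReal_le_ofReal (optValue_sub_value_le M _)
        _ = ENNReal.ofReal H := by simp
        _ ≤ _ := le_add_left le_add_self
  have hmF := (measurable_expectNext_inner alg k hF).lintegral_prod_right' (ν := alg.seedLaw)
  calc _ ≤ ∫⁻ ω, (∫⁻ ξ, F ω.history (alg.select k ω.history ξ) ∂alg.seedLaw
          + (ENNReal.ofReal (C * H * (2 * (H * S * A) * Real.exp (-x)))
            + ENNReal.ofReal H * if IsGood M (value M.tabular π₀) x ω.history then 0 else 1))
          ∂(runLaw M alg k) := lintegral_mono fun ω => hpoint _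
    _ = expectNext M alg k F + (ENNReal.ofReal (C * H * (2 * (H * S * A) * Real.exp (-x)))
          + ENNReal.ofReal H * expectHistory M alg k
            (fun D => if IsGood M (value M.tabular π₀) x D then 0 else 1)) := by
        rw [lintegral_add_left hmF, lintegral_add_left measurable_const,
          lintegral_const_mul' _ _ ENNReal.ofReal_ne_top]
        simp [expectNext, expectHistory]
    _ ≤ expectNext M alg k F + (ENNReal.ofReal (C * H * (2 * (H * S * A) * Real.exp (-x)))
          + ENNReal.ofReal H * ENNReal.ofReal
            (Real.exp (-x) * (H * S * A * (k * (S + 2) + S)))) := by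
        gcongr
        exact expectHistory_not_isGood_le M alg hV hx k
    _ = _ := by
        rw [hEF, ← ENNReal.ofReal_mul (Nat.cast_nonneg H),
          ← ENNReal.ofReal_add (by positivity) (by positivity)]
        congr 2
        ring

lemma regret_le_of_lintegral_le (M : MDP H S A) (alg : Algorithm H S A) (K : ℕ) {B : ℝ}
    (hB0 : 0 ≤ B)
    (hB : ∑ k ∈ Finset.range K, expectNext M alg k (fun _ π => ENNReal.ofReal
      (optValue M.tabular 0 M.init - value M.tabular π 0 M.init)) ≤ ENNReal.ofReal B) :
    regret M alg K ≤ B := by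
  have hgap : ∀ π, 0 ≤ optValue M.tabular 0 M.init - value M.tabular π 0 M.init := fun π =>
    sub_nonneg.2 (value_le_optValue M π)
  have hm : Measurable fun ω : Run alg K =>
      ∑ k : Fin K, (optValue M.tabular 0 M.init - value M.tabular (ω.policy k) 0 M.init) :=
    Finset.measurable_fun_sum _ fun k _ => (measurable_of_finite fun π =>
      optValue M.tabular 0 M.init - value M.tabular π 0 M.init).comp (measurable_policy k)
  unfold regret
  rw [integral_eq_lintegral_of_nonneg_ae (Filter.Eventually.of_forall fun ω =>
    Finset.sum_nonneg fun k _ => hgap _) hm.aestronglyMeasurable]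
  refine ENNReal.toReal_le_of_le_ofReal hB0 ?_
  rw [← lintegral_sum_policy M alg] at hB
  refine le_trans (le_of_eq (lintegral_congr fun ω => ?_)) hB
  exact ENNReal.ofReal_sum_of_nonneg fun k _ => hgap _

lemma sum_expectNext_gap_le_mul [NeZero A] (M : MDP H S A) (alg : Algorithm H S A) (K : ℕ) :
    ∑ k ∈ Finset.range K, expectNext M alg k (fun _ π => ENNReal.ofReal
      (optValue M.tabular 0 M.init - value M.tabular π 0 M.init)) ≤ ENNReal.ofReal (H * K) := by
  calc _ ≤ ∑ _k ∈ Finset.range K, ENNReal.ofReal H := by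
        refine Finset.sum_le_sum fun k _ => ?_
        refine (expectNext_mono M alg k (G := fun _ _ => ENNReal.ofReal H) fun D π =>
          ENNReal.ofReal_le_ofReal (optValue_sub_value_le M π)).trans ?_
        simp [expectNext]
    _ = _ := by
        rw [Finset.sum_const, Finset.card_range, nsmul_eq_mul, mul_comm (H : ℝ),
          ENNReal.ofReal_mul (Nat.cast_nonneg K), ENNReal.ofReal_natCast K]

lemma half_le_log {N : ℝ} (hN : 2 ≤ N) : 1 / 2 ≤ Real.log N := by
  have h1 := Real.log_le_log (by norm_num) hN
  linarith [Real.log_two_gt_d9]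

/-- For the tuning `b = S H³ L / 2` and `x = 4 L`, the bonus has scale `L S H^{3/2}`. -/
lemma bonusScale_le {L : ℝ} (hL : 1 / 2 ≤ L) (hH : 0 < H) (hS : 0 < S) :
    bonusScale H S (1 / 2 * S * H ^ 3 * L) (4 * L) ≤ 12 * L * S * (H * √(H : ℝ)) := by
  have hH1 : (1 : ℝ) ≤ H := by exact_mod_cast hH
  have hS1 : (1 : ℝ) ≤ S := by exact_mod_cast hS
  have hsH : 1 ≤ √(H : ℝ) := Real.one_le_sqrt.2 hH1
  have hL0 : 0 < L := by linarith
  have e1 : √(2 * (4 * L)) * √(1 / 2 * S * H ^ 3 * L) = 2 * L * H * (√(H : ℝ) * √(S : ℝ)) := by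
    rw [← Real.sqrt_mul (by positivity), ← Real.sqrt_mul (by positivity),
      show 2 * (4 * L) * (1 / 2 * S * H ^ 3 * L) = (2 * L * H) ^ 2 * (H * S : ℝ) by ring,
      Real.sqrt_mul (by positivity), Real.sqrt_sq (by positivity)]
  have h2 : √(S : ℝ) ≤ S := by
    rw [Real.sqrt_le_left (by positivity)]; nlinarith
  have h3 : √(4 * L) ≤ 4 * L := by
    rw [Real.sqrt_le_left (by positivity)]; nlinarith
  have h4 : 2 * L * H * (√(H : ℝ) * √(S : ℝ)) ≤ 2 * L * H * (√(H : ℝ) * S) := by gcongr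
  have h5 : (1 + (H : ℝ) * S) * √(4 * L) ≤ (2 * (H * S)) * (4 * L) := by
    gcongr
    nlinarith
  have h6 : (2 * ((H : ℝ) * S)) * (4 * L) * 1 ≤ (2 * (H * S)) * (4 * L) * √(H : ℝ) := by gcongr
  unfold bonusScale
  rw [mul_assoc, e1]
  nlinarith

/-- The cost of the bad histories and of large noise is of order `1 / √(k + 1)`; it adds up to order
`√K`, below the main term. -/
lemma failure_le {C : ℝ} (hC : 1 ≤ C) {H S A : ℕ} (hH : 0 < H) (hS : 0 < S) (hA : 0 < A) (k : ℕ) :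
    H * (Real.exp (-(4 * Real.log (2 * H * S * A * (k + 1 : ℕ))))
        * (H * S * A * (k * (S + 2) + S)))
      + C * H * (2 * (H * S * A) * Real.exp (-(4 * Real.log (2 * H * S * A * (k + 1 : ℕ)))))
      ≤ 2 * C * (√((k : ℝ) + 1))⁻¹ := by
  have hH1 : (1 : ℝ) ≤ H := by exact_mod_cast hH
  have hS1 : (1 : ℝ) ≤ S := by exact_mod_cast hS
  have hA1 : (1 : ℝ) ≤ A := by exact_mod_cast hA
  have hk : (0 : ℝ) ≤ k := Nat.cast_nonneg k
  set N : ℝ := 2 * H * S * A * (k + 1 : ℕ) with hN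
  have hNe : N = 2 * H * S * A * ((k : ℝ) + 1) := by rw [hN]; push_cast; ring
  have hHSA : 1 ≤ (H : ℝ) * S * A := by
    have := mul_le_mul hH1 hS1 zero_le_one (by linarith)
    have := mul_le_mul this hA1 zero_le_one (by positivity)
    simpa using this
  have hSN : 2 * (H : ℝ) * S * ((k : ℝ) + 1) ≤ N := by
    rw [hNe]
    have : 2 * (H : ℝ) * S * ((k : ℝ) + 1) * 1 ≤ 2 * (H : ℝ) * S * ((k : ℝ) + 1) * A := by gcongr
    linarith
  have hHN : 2 * (H : ℝ) * ((k : ℝ) + 1) ≤ N := by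
    have : 2 * (H : ℝ) * ((k : ℝ) + 1) * 1 ≤ 2 * (H : ℝ) * ((k : ℝ) + 1) * S := by gcongr
    linarith
  have hkN : (k : ℝ) + 1 ≤ N := by nlinarith
  have hN1 : 1 ≤ N := by linarith
  have hN0 : 0 < N := by linarith
  have hexp : Real.exp (-(4 * Real.log N)) = (N ^ 4)⁻¹ := by
    rw [Real.exp_neg, show 4 * Real.log N = ((4 : ℕ) : ℝ) * Real.log N by norm_num,
      Real.exp_nat_mul, Real.exp_log hN0]
  have hSk : (k : ℝ) * (S + 2) + S ≤ 3 * S * (k + 1) := by nlinarith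
  have h1 : (H : ℝ) * (H * S * A * (k * (S + 2) + S)) ≤ N ^ 3 * (k + 1 : ℝ)⁻¹ := by
    have a1 : (H : ℝ) * (H * S * A * (k * (S + 2) + S)) ≤ H * (H * S * A * (3 * S * (k + 1))) := by
      gcongr
    have a2 : (H : ℝ) * (H * S * A * (3 * S * (k + 1))) ≤ N * N := by
      have b1 : (H : ℝ) * (H * S * A * (3 * S * (k + 1)))
          = 3 / 4 * ((2 * H * S * A) * (2 * H * S * (k + 1))) := by ring
      have b2 : (2 : ℝ) * H * S * A ≤ N := by
        rw [hNe]
        exact le_mul_of_one_le_right (by positivity) (by linarith)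
      have b3 := mul_le_mul b2 hSN (by positivity) hN0.le
      have b4 : 0 ≤ (2 * (H : ℝ) * S * A) * (2 * H * S * (k + 1)) := by positivity
      rw [b1]
      linarith
    have a3 : N * N ≤ N ^ 3 * (k + 1 : ℝ)⁻¹ := by
      rw [← div_eq_mul_inv, le_div_iff₀ (by positivity)]
      have := mul_le_mul_of_nonneg_left hkN (by positivity : 0 ≤ N * N)
      linarith [this, (by ring : N ^ 3 = N * N * N)]
    linarith
  have h2 : (H : ℝ) * (2 * (H * S * A)) ≤ N ^ 3 * (k + 1 : ℝ)⁻¹ := by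
    rw [← div_eq_mul_inv, le_div_iff₀ (by positivity)]
    have a1 : (H : ℝ) * (2 * (H * S * A)) * (k + 1) = H * N := by rw [hNe]; ring
    have a2 : (H : ℝ) ≤ N := by nlinarith
    rw [a1]
    have a3 : (H : ℝ) * N ≤ N * N := by gcongr
    have a4 := mul_le_mul_of_nonneg_left hN1 (by positivity : 0 ≤ N * N)
    nlinarith
  have h3 : (k + 1 : ℝ)⁻¹ ≤ (√((k : ℝ) + 1))⁻¹ := by
    gcongr
    rw [Real.sqrt_le_left (by positivity)]
    nlinarith
  have h4 : (N ^ 4)⁻¹ * (N ^ 3 * (k + 1 : ℝ)⁻¹) ≤ (k + 1 : ℝ)⁻¹ := by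
    have : (N ^ 4)⁻¹ * N ^ 3 ≤ 1 := by
      rw [inv_mul_le_one₀ (by positivity)]
      exact pow_le_pow_right₀ hN1 (by norm_num)
    rw [← mul_assoc]
    exact mul_le_of_le_one_left (by positivity) this
  rw [hexp]
  have h5 := mul_le_mul_of_nonneg_left h1 (by positivity : 0 ≤ (N ^ 4)⁻¹)
  have h6 := mul_le_mul_of_nonneg_left h2 (by positivity : 0 ≤ (N ^ 4)⁻¹)
  have h7 := mul_le_mul_of_nonneg_left ((h6.trans h4).trans h3) (by linarith : 0 ≤ C)
  have h8 : (1 : ℝ) * (√((k : ℝ) + 1))⁻¹ ≤ C * (√((k : ℝ) + 1))⁻¹ := by gcongr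
  linarith [(h5.trans h4).trans h3]

/-- The numerical core: `a` is the first-order term, `b` the second-order term, and `H K` the
trivial bound. Since `min (H K) b ≤ √(H K b)`, the second-order term contributes only
`H^{11/4} S^{3/2} √(A K)`, up to logarithms. -/
lemma min_bound_le {C L H S A K r : ℝ} (hC : 1 ≤ C) (hL : 1 / 2 ≤ L) (hH : 1 ≤ H) (hS : 1 ≤ S)
    (hA : 1 ≤ A) (hK : 1 ≤ K) (h1 : r ≤ H * K)
    (h2 : r ≤ (3 * C * (12 * L * S * (H * √H)) * (2 * H * √(S * A * K)) + 4 * C * √K)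
      + 3 * C * (96 * L ^ 2 * S ^ 2 * H ^ 3 * √H) * (2 * (H * S * A) * L)) :
    r ≤ 300 * C * L ^ 2 * (H ^ 3 * (S * √S) * √(A * K)) := by
  have hC0 : 0 < C := by linarith
  have hL0 : 0 < L := by linarith
  have hH0 : 0 < H := by linarith
  have hS0 : 0 < S := by linarith
  have hA0 : 0 < A := by linarith
  have hK0 : 0 < K := by linarith
  have hsH : √H ≤ H := by rw [Real.sqrt_le_left hH0.le]; nlinarith
  have hsS1 : 1 ≤ √S := Real.one_le_sqrt.2 hS
  have hLL : L ≤ 2 * L ^ 2 := by nlinarith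
  have hL2 : 1 ≤ 4 * L ^ 2 := by nlinarith
  set X := H ^ 3 * (S * √S) * √(A * K) with hX
  have hX0 : 0 ≤ X := by positivity
  have t1 : 3 * C * (12 * L * S * (H * √H)) * (2 * H * √(S * A * K)) ≤ 144 * C * L ^ 2 * X := by
    rw [show S * A * K = S * (A * K) by ring, Real.sqrt_mul hS0.le]
    calc 3 * C * (12 * L * S * (H * √H)) * (2 * H * (√S * √(A * K)))
        = 72 * C * (L * (√H * (H ^ 2 * (S * √S) * √(A * K)))) := by ring
      _ ≤ 72 * C * (2 * L ^ 2 * (H * (H ^ 2 * (S * √S) * √(A * K)))) := by gcongr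
      _ = _ := by rw [hX]; ring
  have t2 : 4 * C * √K ≤ 16 * C * L ^ 2 * X := by
    have a1 : √K ≤ √(A * K) := Real.sqrt_le_sqrt (le_mul_of_one_le_left hK0.le hA)
    have a2 : 1 ≤ H ^ 3 * (S * √S) := by
      have b1 : 1 ≤ S * √S := by nlinarith
      have b2 : 1 ≤ H ^ 3 := one_le_pow₀ hH
      nlinarith
    have a3 : 1 * √(A * K) ≤ H ^ 3 * (S * √S) * √(A * K) := by gcongr
    have a4 : √K ≤ X := by rw [hX]; linarith
    calc 4 * C * √K ≤ 4 * C * (1 * X) := by rw [one_mul]; gcongr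
      _ ≤ 4 * C * (4 * L ^ 2 * X) := by gcongr
      _ = _ := by ring
  set b := 3 * C * (96 * L ^ 2 * S ^ 2 * H ^ 3 * √H) * (2 * (H * S * A) * L) with hb
  have hb0 : 0 ≤ b := by positivity
  have t3 : √(H * K * b) ≤ 48 * C * L ^ 2 * X := by
    refine Real.sqrt_le_iff.2 ⟨by positivity, ?_⟩
    have hXsq : X ^ 2 = H ^ 6 * S ^ 3 * (A * K) := by
      rw [hX, mul_pow, mul_pow, mul_pow, Real.sq_sqrt hS0.le, Real.sq_sqrt (by positivity)]
      ring
    calc H * K * b = 576 * (C * L ^ 3) * (√H * (H ^ 5 * S ^ 3 * (A * K))) := by rw [hb]; ring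
      _ ≤ 576 * (C * L ^ 3) * (H * (H ^ 5 * S ^ 3 * (A * K))) := by gcongr
      _ = 576 * (C * L ^ 3) * 1 * X ^ 2 := by rw [hXsq]; ring
      _ ≤ 576 * (C * L ^ 3) * (4 * (C * L)) * X ^ 2 := by
          gcongr
          nlinarith
      _ = _ := by ring
  have t4 : r ≤ 144 * C * L ^ 2 * X + 16 * C * L ^ 2 * X + √(H * K * b) := by
    by_cases hcase : b ≤ H * K
    · have : b ≤ √(H * K * b) := Real.le_sqrt_of_sq_le (by nlinarith)
      linarith
    · have : H * K ≤ √(H * K * b) := Real.le_sqrt_of_sq_le (by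
        rw [sq]
        exact mul_le_mul_of_nonneg_left (not_le.1 hcase).le (by positivity))
      have h0 : 0 ≤ C * L ^ 2 * X := by positivity
      linarith
  have h0 : 0 ≤ C * L ^ 2 * X := by positivity
  linarith

/-- The regret bound for every MDP of the given sizes. -/
lemma regret_rlsvi_le (hH : 0 < H) (hS : 0 < S) (hA : 0 < A) {K : ℕ} (hK : 0 < K) (M : MDP H S A)
    (pick : Set (Policy H S A) → Policy H S A)
    (hpick : ∀ T : Set (Policy H S A), T.Nonempty → pick T ∈ T) :
    regret M (rlsvi (fun k : ℕ => (1 / 2 : ℝ) * S * H ^ 3 * Real.log (2 * H * S * A * k)) pick) K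
      ≤ 300 * (1 + 2 / optimismProb) * Real.log (2 * H * S * A * K) ^ 2
        * (H ^ 3 * (S * √(S : ℝ)) * √(A * K)) := by
  have : NeZero A := ⟨hA.ne'⟩
  have hH1 : (1 : ℝ) ≤ H := by exact_mod_cast hH
  have hS1 : (1 : ℝ) ≤ S := by exact_mod_cast hS
  have hA1 : (1 : ℝ) ≤ A := by exact_mod_cast hA
  have hK1 : (1 : ℝ) ≤ K := by exact_mod_cast hK
  have hHSA : 1 ≤ (H : ℝ) * S * A := by
    have := mul_le_mul hH1 hS1 zero_le_one (by linarith)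
    have := mul_le_mul this hA1 zero_le_one (by positivity)
    simpa using this
  obtain ⟨π₀, hπ₀⟩ := exists_value_eq_optValue M
  set β : ℕ → ℝ := fun k : ℕ => (1 / 2 : ℝ) * S * H ^ 3 * Real.log (2 * H * S * A * k) with hβ
  set C := 1 + 2 / optimismProb with hCdef
  have hC : 1 ≤ C := by
    have := optimismProb_pos
    have : 0 ≤ 2 / optimismProb := by positivity
    linarith
  set L := Real.log (2 * H * S * A * K) with hLdef
  have hlog : ∀ n : ℕ, 0 < n → 1 / 2 ≤ Real.log (2 * H * S * A * n) := fun n hn => by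
    refine half_le_log ?_
    have hn1 : (1 : ℝ) ≤ n := by exact_mod_cast hn
    have := mul_le_mul hHSA hn1 zero_le_one (by positivity)
    linarith
  have hL : 1 / 2 ≤ L := hlog K hK
  set G := 12 * L * S * (H * √(H : ℝ)) with hG
  set G₂ := 96 * L ^ 2 * S ^ 2 * H ^ 3 * √(H : ℝ) with hG₂
  set alg := rlsvi β pick with halg
  have hepisode : ∀ k ∈ Finset.range K, expectNext M alg k (fun _ π => ENNReal.ofReal
        (optValue M.tabular 0 M.init - value M.tabular π 0 M.init))
      ≤ ENNReal.ofReal (3 * C * G)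
          * expectNext M alg k (fun D π => ENNReal.ofReal
            (value ⟨M.tabular.P, fun h s a => (√((visits D h s a : ℝ) + 1))⁻¹⟩ π 0 M.init))
        + ENNReal.ofReal (3 * C * G₂)
          * expectNext M alg k (fun D π => ENNReal.ofReal
            (value ⟨M.tabular.P, fun h s a => ((visits D h s a : ℝ) + 1)⁻¹⟩ π 0 M.init))
        + ENNReal.ofReal (2 * C * (√((k : ℝ) + 1))⁻¹) := by
    intro k hk
    have hkK : k + 1 ≤ K := Finset.mem_range.1 hk
    set Lk := Real.log (2 * H * S * A * (k + 1 : ℕ)) with hLk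
    have hLk1 : 1 / 2 ≤ Lk := hlog (k + 1) (Nat.succ_pos k)
    have hLkL : Lk ≤ L := by
      refine Real.log_le_log (by positivity) ?_
      have : ((k + 1 : ℕ) : ℝ) ≤ K := by exact_mod_cast hkK
      gcongr
    have hβk : β (k + 1) = 1 / 2 * S * H ^ 3 * Lk := rfl
    have hscale := bonusScale_le hLk1 hH hS
    have hG' : bonusScale H S (β (k + 1)) (4 * Lk) ≤ G := by
      rw [hβk]
      refine hscale.trans ?_
      rw [hG]
      gcongr
    have hG₂' : secondScale H S (β (k + 1)) (4 * Lk) ≤ G₂ := by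
      unfold secondScale
      calc 2 * (H : ℝ) ^ 2 * S * (4 * Lk) * bonusScale H S (β (k + 1)) (4 * Lk)
          ≤ 2 * (H : ℝ) ^ 2 * S * (4 * L) * G := by
            have := bonusScale_nonneg H S (β (k + 1)) (4 * Lk)
            gcongr
        _ = G₂ := by rw [hG, hG₂]; ring
    have hb : (H : ℝ) ^ 3 * S * (4 * Lk) ≤ 9 * β (k + 1) := by
      rw [hβk]
      have : 0 ≤ (H : ℝ) ^ 3 * S * Lk := by positivity
      linarith
    refine (expectNext_gap_le M alg (by linarith) k (fun D hD =>
      lintegral_gap_rlsvi_le M β pick hpick hπ₀ (by linarith) hb hD) hG' hG₂').trans ?_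
    gcongr
    exact failure_le hC hH hS hA k
  have hsum : ∑ k ∈ Finset.range K, expectNext M alg k (fun _ π => ENNReal.ofReal
        (optValue M.tabular 0 M.init - value M.tabular π 0 M.init))
      ≤ ENNReal.ofReal ((3 * C * G * (2 * H * √(S * A * K)) + 4 * C * √(K : ℝ))
        + 3 * C * G₂ * (2 * (H * S * A) * L)) := by
    refine (Finset.sum_le_sum hepisode).trans ?_
    rw [Finset.sum_add_distrib, Finset.sum_add_distrib, ← Finset.mul_sum, ← Finset.mul_sum,
      ← ENNReal.ofReal_sum_of_nonneg fun k _ => by positivity]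
    have hG0 : 0 ≤ G := by positivity
    have hG20 : 0 ≤ G₂ := by positivity
    have hlogK : Real.log ((K : ℝ) + 1) ≤ L := by
      refine Real.log_le_log (by positivity) ?_
      have : 1 * (K : ℝ) ≤ (H * S * A) * K := by gcongr
      linarith
    calc _ ≤ ENNReal.ofReal (3 * C * G) * ENNReal.ofReal (2 * H * √(S * A * K))
          + ENNReal.ofReal (3 * C * G₂) * ENNReal.ofReal (2 * (H * S * A) * L)
          + ENNReal.ofReal (4 * C * √(K : ℝ)) := by
          gcongr
          · exact sum_expectNext_inv_sqrt_le M alg K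
          · refine (sum_expectNext_inv_le M alg K).trans (ENNReal.ofReal_le_ofReal ?_)
            gcongr
          · rw [← Finset.mul_sum]
            have := mul_le_mul_of_nonneg_left (sum_inv_sqrt_le K) (by linarith : 0 ≤ 2 * C)
            linarith
      _ = _ := by
          rw [← ENNReal.ofReal_mul (by positivity), ← ENNReal.ofReal_mul (by positivity),
            ← ENNReal.ofReal_add (by positivity) (by positivity),
            ← ENNReal.ofReal_add (by positivity) (by positivity)]
          congr 1
          ring
  exact min_bound_le hC hL hH1 hS1 hA1 hK1
    (regret_le_of_lintegral_le M alg K (by positivity) (sum_expectNext_gap_le_mul M alg K))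
    (regret_le_of_lintegral_le M alg K (by positivity) hsum)

end Total

end RVF

end

theorem theorem1 :
    ∃ C : ℝ, 0 < C ∧ ∃ p : ℕ,
      ∀ H S A K : ℕ, 0 < H → 0 < S → 0 < A → 0 < K →
      ∀ pick : Set (RVF.Policy H S A) → RVF.Policy H S A,
        (∀ T : Set (RVF.Policy H S A), T.Nonempty → pick T ∈ T) →
        RVF.worstCaseRegret
            (RVF.rlsvi
              (fun k : ℕ =>
                (1 / 2 : ℝ) * (S : ℝ) * (H : ℝ) ^ 3 *
                  Real.log (2 * (H : ℝ) * (S : ℝ) * (A : ℝ) * (k : ℝ)))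
              pick) K
          ≤ ((C * Real.log (2 * (H : ℝ) * (S : ℝ) * (A : ℝ) * (K : ℝ)) ^ p *
                ((H : ℝ) ^ 3 * (S : ℝ) ^ (3 / 2 : ℝ) * √((A : ℝ) * (K : ℝ))) : ℝ) : EReal) := by
  have hp := RVF.optimismProb_pos
  refine ⟨300 * (1 + 2 / RVF.optimismProb), by positivity, 2, ?_⟩
  intro H S A K hH hS hA hK pick hpick
  refine iSup_le fun M => EReal.coe_le_coe_iff.2 ?_
  have hS0 : (0 : ℝ) < S := by exact_mod_cast hS
  have e : (S : ℝ) ^ (3 / 2 : ℝ) = S * √(S : ℝ) := by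
    rw [show (3 / 2 : ℝ) = 1 + 1 / 2 by norm_num, Real.rpow_add hS0, Real.rpow_one,
      Real.sqrt_eq_rpow]
  rw [e]
  exact RVF.regret_rlsvi_le hH hS hA hK M pick hpick
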